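/- **Setting.** Let $|x|_m=\min\{|x|,360-|x|\}$. Running times are numbers of operations of a real RAM: a finite program, independent of the input, working on arrays of natural numbers and arrays of extended reals. Memory accesses, literals, additions, subtractions, halving of an index, comparisons, tests, assignments, and evaluations of a given angle cost function $c_a$ at a point of $[0,180]$ are each one operation (two for an evaluation together with its assignment). Let $G$ be a finite directed graph with a source vertex $s$ in which every vertex is incident with at least one edge. Every edge $e$ has a cost $c_e\in\mathbb R$ and a direction $\theta_e\in[0,360)$. The cost of a walk $e_1,\dots,e_r$ is $\sum_i c_{e_i}+\sum_{i<r}c_a(|\theta_{e_i}-\theta_{e_{i+1}}|_m)$. *Minimal-angle Bellman-Ford* with parameter $p\ge 1$ and a vertex update routine $U$ is the following algorithm. It starts with $D[e]=c_e$ for the edges $e$ that leave $s$ and $D[e]=\infty$ for all other edges. Then, in each of $p-1$ rounds, it does the following at every vertex $v$. It calls $U$ on the distances $D[e^-]$ at the beginning of the round and the directions of the incoming edges $e^-$ and on the directions of the outgoing edges $e^+$, to obtain for each $e^+$ a predecessor $e^-$. If this improves the distance, it replaces $D[e^+]$ by $D[e^-]+c_a(|\theta_{e^-}-\theta_{e^+}|_m)+c_{e^+}$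 and records the predecessor. **Theorem.** There are a vertex update routine $U$ and a constant $C$ such that for every convex and monotonically increasing angle cost function $c_a:[0,180]\to[0,\infty)$ the following hold. 1. Given a vertex with $k$ incoming edges, with distances $D_i\in\mathbb R\cup\{\infty\}$ and directions $\alpha_i\in[0,360)$, and $l$ outgoing edges, with directions $\beta_j\in[0,360)$, where $k+l\ge1$, the routine $U$ halts after at most $C\,(k+l)\log(2+kl)$ operations. If $k\ge1$, it has then found for each $j$ an optimal predecessor, that is, some $i$ that minimizes $D_i+c_a(|\alpha_i-\beta_j|_m)$. 2. For every $G$ and $p\ge 1$, minimal-angle Bellman-Ford with the update routine $U$ halts after at most $$C\,p\sum_v\big(\delta^-(v)+\delta^+(v)\big)\log\big(2+\delta^+(v)\,\delta^-(v)\big)$$ operations, where $\delta^-(v)$ and $\delta^+(v)$ are the in-degree and out-degree of $v$. For every edge $e$, the final $D[e]$ is the least cost of a walk with at most $p$ edges that starts at $s$ and ends with $e$ ($\infty$ if there is none). If $D[e]<\infty$, then either no predecessor is recorded, $e$ leaves $s$ and $D[e]=c_e$, or the recorded predecessor is an edge $e'$ that ends where $e$ starts and satisfies $D[e']+c_a(|\theta_{e'}-\theta_e|_m)+c_e\le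 D[e]$. -/

import Mathlib

namespace AngleBF

/-! ## The machine model: a real RAM with an oracle for the angle cost function

Memory consists of arrays of natural numbers and arrays of extended reals, each array being named by
a natural number and indexed by natural numbers; a scalar variable is cell `0` of an array. A program
is a finite piece of syntax. Every literal, memory access, arithmetic operation, comparison, test,
assignment and evaluation of the angle cost function is one operation. There is no conversion of
numbers into indices (no rounding) and no multiplication. -/

/-- Memory: `s.nat a i` and `s.num a i` are the `i`-th cells of the arrays named `a`. -/
structure State where
  nat : ℕ → ℕ → ℕ
  num : ℕ → ℕ → EReal

namespace State

def setNat (s : State) (a i x : ℕ) : State :=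
  { s with nat := Function.update s.nat a (Function.update (s.nat a) i x) }

noncomputable def setNum (s : State) (a i : ℕ) (x : EReal) : State :=
  { s with num := Function.update s.num a (Function.update (s.num a) i x) }

end State

/-- Expressions for indices and counters; `sub` is truncated, `half` is division by two, rounded
down. -/
inductive NExp where
  | lit (n : ℕ)
  | get (a : ℕ) (i : NExp)
  | add (x y : NExp)
  | sub (x y : NExp)
  | half (x : NExp)

namespace NExp

def eval (s : State) : NExp → ℕ
  | lit n => n
  | get a i => s.nat a (i.eval s)
  | add x y => x.eval s + y.eval s
  | sub x y => x.eval s - y.eval s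
  | half x => x.eval s / 2

/-- Number of operations needed to evaluate the expression. -/
def cost : NExp → ℕ
  | lit _ => 1
  | get _ i => i.cost + 1
  | add x y => x.cost + y.cost + 1
  | sub x y => x.cost + y.cost + 1
  | half x => x.cost + 1

/-- The scalar variable `a`. -/
def var (a : ℕ) : NExp := get a (lit 0)

end NExp

/-- Expressions for numbers (reals or infinite). -/
inductive RExp where
  | lit (z : ℤ)
  | infty
  | get (a : ℕ) (i : NExp)
  | add (x y : RExp)
  | sub (x y : RExp)

namespace RExp

noncomputable def eval (s : State) : RExp → EReal
  | lit z => ((z : ℝ) : EReal)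
  | infty => ⊤
  | get a i => s.num a (i.eval s)
  | add x y => x.eval s + y.eval s
  | sub x y => x.eval s - y.eval s

def cost : RExp → ℕ
  | lit _ => 1
  | infty => 1
  | get _ i => i.cost + 1
  | add x y => x.cost + y.cost + 1
  | sub x y => x.cost + y.cost + 1

/-- The scalar variable `a`. -/
def var (a : ℕ) : RExp := get a (NExp.lit 0)

end RExp

/-- Tests. -/
inductive BExp where
  | nlt (x y : NExp)
  | rlt (x y : RExp)
  | not (b : BExp)
  | and (b b' : BExp)

namespace BExp

def holds (s : State) : BExp → Prop
  | nlt x y => x.eval s < y.eval s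
  | rlt x y => x.eval s < y.eval s
  | not b => ¬ b.holds s
  | and b b' => b.holds s ∧ b'.holds s

def cost : BExp → ℕ
  | nlt x y => x.cost + y.cost + 1
  | rlt x y => x.cost + y.cost + 1
  | not b => b.cost + 1
  | and b b' => b.cost + b'.cost + 1

end BExp

/-- Programs. `storeN a i x` is the assignment `a[i] := x` of a natural number, `storeR a i x` that of
a number, and `angleCost a i x` is the oracle call `a[i] := c_a(x)`. -/
inductive Cmd where
  | skip
  | storeN (a : ℕ) (i x : NExp)
  | storeR (a : ℕ) (i : NExp) (x : RExp)
  | angleCost (a : ℕ) (i : NExp) (x : RExp)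
  | seq (p q : Cmd)
  | ite (b : BExp) (p q : Cmd)
  | loop (b : BExp) (p : Cmd)

/-- `Exec c p s s' t`: the program `p`, started in memory `s` and with the angle cost function `c`,
halts in memory `s'` after `t` operations. The oracle answers only on the domain `[0,180]` of the
angle cost function; a call outside of it blocks the run. -/
inductive Exec (c : ℝ → ℝ) : Cmd → State → State → ℕ → Prop
  | skip (s : State) : Exec c Cmd.skip s s 1
  | storeN (s : State) (a : ℕ) (i x : NExp) :
      Exec c (Cmd.storeN a i x) s (s.setNat a (i.eval s) (x.eval s)) (i.cost + x.cost + 1)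
  | storeR (s : State) (a : ℕ) (i : NExp) (x : RExp) :
      Exec c (Cmd.storeR a i x) s (s.setNum a (i.eval s) (x.eval s)) (i.cost + x.cost + 1)
  | angleCost (s : State) (a : ℕ) (i : NExp) (x : RExp) (r : ℝ)
      (hr : r ∈ Set.Icc (0 : ℝ) 180) (hx : x.eval s = (r : EReal)) :
      Exec c (Cmd.angleCost a i x) s (s.setNum a (i.eval s) ((c r : ℝ) : EReal))
        (i.cost + x.cost + 2)
  | seq {p q : Cmd} {s s₁ s₂ : State} {t₁ t₂ : ℕ} (h₁ : Exec c p s s₁ t₁)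
      (h₂ : Exec c q s₁ s₂ t₂) : Exec c (Cmd.seq p q) s s₂ (t₁ + t₂)
  | iteTrue {b : BExp} {p q : Cmd} {s s' : State} {t : ℕ} (hb : b.holds s)
      (h : Exec c p s s' t) : Exec c (Cmd.ite b p q) s s' (b.cost + 1 + t)
  | iteFalse {b : BExp} {p q : Cmd} {s s' : State} {t : ℕ} (hb : ¬ b.holds s)
      (h : Exec c q s s' t) : Exec c (Cmd.ite b p q) s s' (b.cost + 1 + t)
  | loopDone {b : BExp} {p : Cmd} {s : State} (hb : ¬ b.holds s) :
      Exec c (Cmd.loop b p) s s (b.cost + 1)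
  | loopStep {b : BExp} {p : Cmd} {s s₁ s₂ : State} {t₁ t₂ : ℕ} (hb : b.holds s)
      (h₁ : Exec c p s s₁ t₁) (h₂ : Exec c (Cmd.loop b p) s₁ s₂ t₂) :
      Exec c (Cmd.loop b p) s s₂ (b.cost + 1 + t₁ + t₂)

/-- Programs are deterministic: final memory and operation count are determined by the input. -/
theorem Exec.unique {c : ℝ → ℝ} {p : Cmd} {s s₁ s₂ : State} {t₁ t₂ : ℕ}
    (h₁ : Exec c p s s₁ t₁) (h₂ : Exec c p s s₂ t₂) : s₁ = s₂ ∧ t₁ = t₂ := by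
  induction h₁ generalizing s₂ t₂ with
  | skip s => cases h₂; exact ⟨rfl, rfl⟩
  | storeN => cases h₂; exact ⟨rfl, rfl⟩
  | storeR => cases h₂; exact ⟨rfl, rfl⟩
  | angleCost s a i x r hr hx =>
    cases h₂ with
    | angleCost _ _ _ _ r' hr' hx' =>
      have : r = r' := by rw [hx] at hx'; exact_mod_cast hx'
      subst this; exact ⟨rfl, rfl⟩
  | seq _ _ ih₁ ih₂ =>
    cases h₂ with
    | seq g₁ g₂ =>
      obtain ⟨rfl, rfl⟩ := ih₁ g₁
      obtain ⟨rfl, rfl⟩ := ih₂ g₂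
      exact ⟨rfl, rfl⟩
  | iteTrue hb _ ih =>
    cases h₂ with
    | iteTrue _ g => obtain ⟨rfl, rfl⟩ := ih g; exact ⟨rfl, rfl⟩
    | iteFalse hb' _ => exact absurd hb hb'
  | iteFalse hb _ ih =>
    cases h₂ with
    | iteTrue hb' _ => exact absurd hb' hb
    | iteFalse _ g => obtain ⟨rfl, rfl⟩ := ih g; exact ⟨rfl, rfl⟩
  | loopDone hb =>
    cases h₂ with
    | loopDone _ => exact ⟨rfl, rfl⟩
    | loopStep hb' _ _ => exact absurd hb' hb
  | loopStep hb _ _ ih₁ ih₂ =>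
    cases h₂ with
    | loopDone hb' => exact absurd hb hb'
    | loopStep _ g₁ g₂ =>
      obtain ⟨rfl, rfl⟩ := ih₁ g₁
      obtain ⟨rfl, rfl⟩ := ih₂ g₂
      exact ⟨rfl, rfl⟩

/-! ## Angles and graphs -/

/-- `|x|_m = min {|x|, 360 - |x|}`, the smaller of the two angles between directions that differ by
`x` degrees. -/
noncomputable def angle (x : ℝ) : ℝ := min |x| (360 - |x|)

/-- A finite directed graph with vertices `0, …, n-1`, edges `0, …, m-1` (parallel edges and loops
are allowed) and a source vertex. The edge `e` leads from `tail e` to `head e`, has cost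
`edgeCost e`, and points in direction `dir e`, in degrees from a fixed direction. -/
structure Graph where
  n : ℕ
  m : ℕ
  tail : Fin m → Fin n
  head : Fin m → Fin n
  dir : Fin m → ℝ
  dir_mem : ∀ e, dir e ∈ Set.Ico (0 : ℝ) 360
  edgeCost : Fin m → ℝ
  source : Fin n

namespace Graph

variable (G : Graph)

/-- The number `δ⁻(v)` of incoming edges. -/
def inDeg (v : Fin G.n) : ℕ := (Finset.univ.filter fun e => G.head e = v).card

/-- The number `δ⁺(v)` of outgoing edges. -/
def outDeg (v : Fin G.n) : ℕ := (Finset.univ.filter fun e => G.tail e = v).card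

/-- `w` is the list of edges of a walk that starts at the source and whose last edge is `e`. -/
def IsWalkTo (e : Fin G.m) (w : List (Fin G.m)) : Prop :=
  w.IsChain (fun a b => G.head a = G.tail b) ∧
    (∃ a, w.head? = some a ∧ G.tail a = G.source) ∧ w.getLast? = some e

/-- Edge costs plus angle costs of all pairs of consecutive edges. -/
noncomputable def walkCost (c : ℝ → ℝ) : List (Fin G.m) → ℝ
  | [] => 0
  | [e] => G.edgeCost e
  | e :: e' :: w => G.edgeCost e + c (angle (G.dir e - G.dir e')) + walkCost c (e' :: w)

/-- The least cost of a walk from the source with at most `p` edges and last edge `e`; it is `⊤` if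
there is no such walk. -/
noncomputable def minCost (c : ℝ → ℝ) (p : ℕ) (e : Fin G.m) : EReal :=
  ⨅ w ∈ {w : List (Fin G.m) | G.IsWalkTo e w ∧ w.length ≤ p}, ((G.walkCost c w : ℝ) : EReal)

end Graph

/-! ## Memory layout -/

/-- Names of arrays of natural numbers. -/
abbrev nK : ℕ := 0
abbrev nL : ℕ := 1
abbrev nPred : ℕ := 2
abbrev nVertices : ℕ := 3
abbrev nEdges : ℕ := 4
abbrev nP : ℕ := 5
abbrev nSource : ℕ := 6
abbrev nInOff : ℕ := 7
abbrev nInEdge : ℕ := 8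
abbrev nOutOff : ℕ := 9
abbrev nOutEdge : ℕ := 10
abbrev nParent : ℕ := 11
abbrev nT : ℕ := 12
abbrev nV : ℕ := 13
abbrev nJ : ℕ := 14
abbrev nE : ℕ := 15
abbrev nI : ℕ := 16

/-- Names of arrays of numbers. -/
abbrev rInDist : ℕ := 0
abbrev rInDir : ℕ := 1
abbrev rOutDir : ℕ := 2
abbrev rDir : ℕ := 3
abbrev rEdgeCost : ℕ := 4
abbrev rDist : ℕ := 5
abbrev rNewDist : ℕ := 6
abbrev rX : ℕ := 7
abbrev rY : ℕ := 8

/-- The memory holds the data of one vertex: the numbers `k` and `l` of incoming and outgoing edges,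
the distances `D i` and directions `α i` of the incoming edges, and the directions `β j` of the
outgoing edges. All other cells are arbitrary. -/
def HoldsVertex (s : State) {k l : ℕ} (D : Fin k → EReal) (α : Fin k → ℝ) (β : Fin l → ℝ) : Prop :=
  s.nat nK 0 = k ∧ s.nat nL 0 = l ∧
    (∀ i : Fin k, s.num rInDist i = D i ∧ s.num rInDir i = (α i : EReal)) ∧
    ∀ j : Fin l, s.num rOutDir j = (β j : EReal)

/-- The memory holds `p` and the graph `G`, given by its edge data and its adjacency arrays: the
incoming edges of `v` are listed, in any order, in the cells of `nInEdge` from position `nInOff[v]`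
up to, but excluding, `nInOff[v+1]`, and likewise for the outgoing edges. All other cells are
arbitrary. -/
def HoldsGraph (s : State) (G : Graph) (p : ℕ) : Prop :=
  s.nat nVertices 0 = G.n ∧ s.nat nEdges 0 = G.m ∧ s.nat nP 0 = p ∧
    s.nat nSource 0 = (G.source : ℕ) ∧
    (∀ e : Fin G.m, s.num rDir e = (G.dir e : EReal) ∧ s.num rEdgeCost e = (G.edgeCost e : EReal)) ∧
    (∀ v : Fin G.n, s.nat nInOff (v + 1) = s.nat nInOff v + G.inDeg v ∧
      (∀ j < G.inDeg v, ∃ e : Fin G.m, G.head e = v ∧ s.nat nInEdge (s.nat nInOff v + j) = e) ∧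
      ∀ e : Fin G.m, G.head e = v → ∃ j < G.inDeg v, s.nat nInEdge (s.nat nInOff v + j) = e) ∧
    ∀ v : Fin G.n, s.nat nOutOff (v + 1) = s.nat nOutOff v + G.outDeg v ∧
      (∀ j < G.outDeg v, ∃ e : Fin G.m, G.tail e = v ∧ s.nat nOutEdge (s.nat nOutOff v + j) = e) ∧
      ∀ e : Fin G.m, G.tail e = v → ∃ j < G.outDeg v, s.nat nOutEdge (s.nat nOutOff v + j) = e

/-! ## Minimal-angle Bellman-Ford -/

namespace Cmd

/-- Sequential composition of a list of programs. -/
def block : List Cmd → Cmd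
  | [] => skip
  | [p] => p
  | p :: q :: r => seq p (block (q :: r))

/-- `x := e` for a scalar variable `x`. -/
def setN (x : ℕ) (e : NExp) : Cmd := storeN x (NExp.lit 0) e

/-- `x := e` for a scalar variable `x`. -/
def setR (x : ℕ) (e : RExp) : Cmd := storeR x (NExp.lit 0) e

/-- `for x = a, …, b - 1 do p`. -/
def forRange (x : ℕ) (a b : NExp) (p : Cmd) : Cmd :=
  block [setN x a,
    loop (BExp.nlt (NExp.var x) b) (block [p, setN x (NExp.add (NExp.var x) (NExp.lit 1))])]

end Cmd

open Cmd

/-- `j`-th edge in the adjacency array `edge` with offsets `off`, at the current vertex. -/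
def adj (off edge : ℕ) (j : NExp) : NExp :=
  NExp.get edge (NExp.add (NExp.get off (NExp.var nV)) j)

/-- Degree of the current vertex, from the offsets. -/
def degree (off : ℕ) : NExp :=
  NExp.sub (NExp.get off (NExp.add (NExp.var nV) (NExp.lit 1))) (NExp.get off (NExp.var nV))

/-- `D[e] := ∞` and no predecessor (written as the number of edges) for all edges, then
`D[e] := edgeCost e` for the edges that leave the source. -/
def initDist : Cmd :=
  block [
    forRange nE (NExp.lit 0) (NExp.var nEdges) (block [
      storeR rDist (NExp.var nE) RExp.infty,
      storeN nParent (NExp.var nE) (NExp.var nEdges)]),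
    setN nV (NExp.var nSource),
    forRange nJ (NExp.lit 0) (degree nOutOff) (block [
      setN nE (adj nOutOff nOutEdge (NExp.var nJ)),
      storeR rDist (NExp.var nE) (RExp.get rEdgeCost (NExp.var nE))])]

/-- Copy the data of the current vertex to the place where the update routine expects them. -/
def loadVertex : Cmd :=
  block [
    setN nK (degree nInOff),
    setN nL (degree nOutOff),
    forRange nJ (NExp.lit 0) (NExp.var nK) (block [
      setN nE (adj nInOff nInEdge (NExp.var nJ)),
      storeR rInDist (NExp.var nJ) (RExp.get rDist (NExp.var nE)),
      storeR rInDir (NExp.var nJ) (RExp.get rDir (NExp.var nE))]),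
    forRange nJ (NExp.lit 0) (NExp.var nL) (
      storeR rOutDir (NExp.var nJ) (RExp.get rDir (adj nOutOff nOutEdge (NExp.var nJ))))]

/-- `y := c_a(|x|_m)`; the value of `x` is lost. -/
def angleCostOf (x y : ℕ) : Cmd :=
  block [
    ite (BExp.rlt (RExp.var x) (RExp.lit 0)) (setR x (RExp.sub (RExp.lit 0) (RExp.var x))) skip,
    ite (BExp.rlt (RExp.lit 180) (RExp.var x)) (setR x (RExp.sub (RExp.lit 360) (RExp.var x))) skip,
    angleCost y (NExp.lit 0) (RExp.var x)]

/-- With the predecessors chosen by the update routine, improve the distances of the outgoing edges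
of the current vertex. -/
def relaxVertex : Cmd :=
  ite (BExp.nlt (NExp.lit 0) (NExp.var nK))
    (forRange nJ (NExp.lit 0) (NExp.var nL) (block [
      setN nE (adj nOutOff nOutEdge (NExp.var nJ)),
      setN nI (NExp.get nPred (NExp.var nJ)),
      setR rX (RExp.sub (RExp.get rInDir (NExp.var nI)) (RExp.get rOutDir (NExp.var nJ))),
      angleCostOf rX rY,
      setR rY (RExp.add (RExp.get rInDist (NExp.var nI))
        (RExp.add (RExp.var rY) (RExp.get rEdgeCost (NExp.var nE)))),
      ite (BExp.rlt (RExp.var rY) (RExp.get rNewDist (NExp.var nE)))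
        (block [
          storeR rNewDist (NExp.var nE) (RExp.var rY),
          storeN nParent (NExp.var nE) (adj nInOff nInEdge (NExp.var nI))])
        skip]))
    skip

/-- Minimal-angle Bellman-Ford with the vertex update routine `U`: after the initialization there are
`p - 1` rounds; in each round every vertex is updated once, from the distances at the beginning of
the round. -/
def bellmanFord (U : Cmd) : Cmd :=
  block [
    initDist,
    forRange nT (NExp.lit 1) (NExp.var nP) (block [
      forRange nE (NExp.lit 0) (NExp.var nEdges)
        (storeR rNewDist (NExp.var nE) (RExp.get rDist (NExp.var nE))),
      forRange nV (NExp.lit 0) (NExp.var nVertices) (block [loadVertex, U, relaxVertex]),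
      forRange nE (NExp.lit 0) (NExp.var nEdges)
        (storeR rDist (NExp.var nE) (RExp.get rNewDist (NExp.var nE)))])]

end AngleBF

/-!
The vertex update. Raise and lower the direction of every incoming edge by 360 degrees, which gives
three rows per incoming edge, and let the entry of a row with direction `a` and distance `d` in the
column of an outgoing edge with direction `b` be `d + c |a - b|` if `|a - b| ≤ 180`, and `∞`
otherwise. The minimum of a column is the minimum of `d + c_a(|a - b|_m)` over the incoming edges
(`le_entry_lift`, `exists_entry_lift_eq`). Since `c` is convex and increasing, `x ↦ c |x|`, extended by
`∞` beyond 180 degrees, is a convex function on the line. Hence, when rows and columns are sorted by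
direction, a row that is best for a column beats all smaller rows in the later columns and all larger
rows in the earlier columns (`entry_le_of_le`, `entry_le_of_ge`, `BestRowsMonotone`): best rows can be
chosen increasing along the columns.

So it suffices to sort (`runs_mergeSort`) and to find increasing best rows (`runs_bestRows`). For the
latter, the best rows of the columns divisible by `2 * S` confine the search in the other columns
divisible by `S` to intervals of rows that overlap only in end points. Halving `S` therefore costs a
number of operations that is linear in the number of rows and columns (`runs_refineStride`), and there
are logarithmically many strides.

The whole algorithm. The least cost of a walk with at most `t + 1` edges and last edge `e` is the
least of the cost with at most `t` edges and the costs through the predecessors of `e`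
(`Graph.le_minCost_succ`, `Graph.minCost_succ_le_add`). During a round the distance of every edge stays
between the least costs for `t` and `t + 1` edges (`EdgeInv`), and the update of the vertex at which an
edge starts brings it down to the latter (`runs_relaxVertex`). Apart from its output, the update routine
writes only arrays that the main program does not use, so that it leaves the data of the main program
alone for syntactic reasons (`Runs.frame`).

Correctness and operation counts are proved together, with a total correctness judgement `Runs` whose
postcondition also sees the number of operations. The numerical constants in the operation counts are
rough upper bounds.
-/

namespace AngleBF

open Cmd

/-! ### Total correctness with operation counts -/

/-- The program `p`, started in `s`, halts, and the final memory and the number of operations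
satisfy `Q`. -/
def Runs (c : ℝ → ℝ) (p : Cmd) (s : State) (Q : State → ℕ → Prop) : Prop :=
  ∃ s' t, Exec c p s s' t ∧ Q s' t

variable {c : ℝ → ℝ}

theorem Runs.mono {p : Cmd} {s : State} {Q Q' : State → ℕ → Prop} (h : Runs c p s Q)
    (hQ : ∀ s' t, Q s' t → Q' s' t) : Runs c p s Q' := by
  obtain ⟨s', t, h₁, h₂⟩ := h
  exact ⟨s', t, h₁, hQ _ _ h₂⟩

theorem runs_skip {s : State} {Q : State → ℕ → Prop} : Runs c skip s Q ↔ Q s 1 :=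
  ⟨fun ⟨_, _, h, hQ⟩ => by cases h; exact hQ, fun h => ⟨_, _, .skip s, h⟩⟩

theorem runs_storeN {a : ℕ} {i x : NExp} {s : State} {Q : State → ℕ → Prop} :
    Runs c (storeN a i x) s Q ↔ Q (s.setNat a (i.eval s) (x.eval s)) (i.cost + x.cost + 1) :=
  ⟨fun ⟨_, _, h, hQ⟩ => by cases h; exact hQ, fun h => ⟨_, _, .storeN s a i x, h⟩⟩

theorem runs_storeR {a : ℕ} {i : NExp} {x : RExp} {s : State} {Q : State → ℕ → Prop} :
    Runs c (storeR a i x) s Q ↔ Q (s.setNum a (i.eval s) (x.eval s)) (i.cost + x.cost + 1) :=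
  ⟨fun ⟨_, _, h, hQ⟩ => by cases h; exact hQ, fun h => ⟨_, _, .storeR s a i x, h⟩⟩

theorem runs_setN {a : ℕ} {x : NExp} {s : State} {Q : State → ℕ → Prop} :
    Runs c (setN a x) s Q ↔ Q (s.setNat a 0 (x.eval s)) (x.cost + 2) := by
  rw [setN, runs_storeN]
  simp only [NExp.eval, NExp.cost, show 1 + x.cost + 1 = x.cost + 2 by omega]

theorem runs_setR {a : ℕ} {x : RExp} {s : State} {Q : State → ℕ → Prop} :
    Runs c (setR a x) s Q ↔ Q (s.setNum a 0 (x.eval s)) (x.cost + 2) := by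
  rw [setR, runs_storeR]
  simp only [NExp.eval, NExp.cost, show 1 + x.cost + 1 = x.cost + 2 by omega]

theorem runs_angleCost {a : ℕ} {i : NExp} {x : RExp} {s : State} {Q : State → ℕ → Prop} (r : ℝ)
    (hr : r ∈ Set.Icc (0 : ℝ) 180) (hx : x.eval s = (r : EReal))
    (h : Q (s.setNum a (i.eval s) ((c r : ℝ) : EReal)) (i.cost + x.cost + 2)) :
    Runs c (angleCost a i x) s Q :=
  ⟨_, _, .angleCost s a i x r hr hx, h⟩

theorem runs_seq {p q : Cmd} {s : State} {Q : State → ℕ → Prop} :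
    Runs c (seq p q) s Q ↔
      Runs c p s fun s₁ t₁ => Runs c q s₁ fun s₂ t₂ => Q s₂ (t₁ + t₂) := by
  constructor
  · rintro ⟨_, _, h, hQ⟩
    cases h with
    | seq h₁ h₂ => exact ⟨_, _, h₁, _, _, h₂, hQ⟩
  · rintro ⟨_, _, h₁, _, _, h₂, hQ⟩
    exact ⟨_, _, .seq h₁ h₂, hQ⟩

theorem runs_ite {b : BExp} {p q : Cmd} {s : State} {Q : State → ℕ → Prop} :
    Runs c (Cmd.ite b p q) s Q ↔
      (b.holds s → Runs c p s fun s' t => Q s' (b.cost + 1 + t)) ∧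
        (¬ b.holds s → Runs c q s fun s' t => Q s' (b.cost + 1 + t)) := by
  constructor
  · rintro ⟨_, _, h, hQ⟩
    cases h with
    | iteTrue hb h => exact ⟨fun _ => ⟨_, _, h, hQ⟩, fun h' => absurd hb h'⟩
    | iteFalse hb h => exact ⟨fun h' => absurd h' hb, fun _ => ⟨_, _, h, hQ⟩⟩
  · rintro ⟨h₁, h₂⟩
    by_cases hb : b.holds s
    · obtain ⟨_, _, h, hQ⟩ := h₁ hb
      exact ⟨_, _, .iteTrue hb h, hQ⟩
    · obtain ⟨_, _, h, hQ⟩ := h₂ hb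
      exact ⟨_, _, .iteFalse hb h, hQ⟩

theorem block_cons_cons (p q : Cmd) (r : List Cmd) :
    block (p :: q :: r) = seq p (block (q :: r)) := rfl

theorem block_singleton (p : Cmd) : block [p] = p := rfl

/-- The rule for loops: `I s t` is an invariant relating the memory and the number `t` of operations
since the start of the loop, and `μ` is a variant. -/
theorem runs_loop {b : BExp} {p : Cmd} {s : State} (I : State → ℕ → Prop) (μ : State → ℕ)
    (h₀ : I s 0)
    (hstep : ∀ s t, I s t → b.holds s →
      Runs c p s fun s' t' => I s' (t + (b.cost + 1 + t')) ∧ μ s' < μ s) :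
    Runs c (loop b p) s fun s' t => ∃ t₀, I s' t₀ ∧ ¬ b.holds s' ∧ t = t₀ + (b.cost + 1) := by
  suffices H : ∀ m s t, μ s < m → I s t →
      Runs c (loop b p) s fun s' t' => ∃ t₀, I s' t₀ ∧ ¬ b.holds s' ∧ t + t' = t₀ + (b.cost + 1) by
    simpa using H (μ s + 1) s 0 (Nat.lt_succ_self _) h₀
  intro m
  induction m with
  | zero => intro s t h; omega
  | succ m ih =>
    intro s t hm hI
    by_cases hb : b.holds s
    · obtain ⟨s₁, t₁, h₁, hI₁, hμ⟩ := hstep s t hI hb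
      obtain ⟨s₂, t₂, h₂, t₀, hI₂, hb₂, ht⟩ := ih s₁ _ (by omega) hI₁
      exact ⟨s₂, _, .loopStep hb h₁ h₂, t₀, hI₂, hb₂, by omega⟩
    · exact ⟨s, _, .loopDone hb, t, hI, hb, rfl⟩

/-- The rule for counting loops with a bound `T i` on the number of operations of the `i`-th
iteration. -/
theorem runs_forRange_sum {x : ℕ} {a b : NExp} {p : Cmd} {s : State} (I : ℕ → State → Prop)
    (T : ℕ → ℕ) (A B : ℕ) (hA : a.eval s = A) (hAB : A ≤ B) (h₀ : I A (s.setNat x 0 A))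
    (hb : ∀ i s, A ≤ i → i ≤ B → I i s → s.nat x 0 = i → b.eval s = B)
    (hstep : ∀ i s, A ≤ i → i < B → I i s → s.nat x 0 = i →
      Runs c p s fun s' t => t ≤ T i ∧ s'.nat x 0 = i ∧ I (i + 1) (s'.setNat x 0 (i + 1))) :
    Runs c (forRange x a b p) s fun s' t => I B s' ∧ s'.nat x 0 = B ∧
      t ≤ ∑ i ∈ Finset.Ico A B, (T i + b.cost + 10) + (a.cost + b.cost + 6) := by
  rw [forRange, block_cons_cons, block_singleton, runs_seq, runs_setN, hA]
  refine (runs_loop (fun s t => I (s.nat x 0) s ∧ A ≤ s.nat x 0 ∧ s.nat x 0 ≤ B ∧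
      t ≤ ∑ i ∈ Finset.Ico A (s.nat x 0), (T i + b.cost + 10)) (fun s => B - s.nat x 0) ?_ ?_).mono ?_
  · simpa [State.setNat] using ⟨h₀, hAB⟩
  · rintro s t ⟨hI, hA', hB', ht⟩ hlt
    have hbB := hb _ _ hA' hB' hI rfl
    simp only [BExp.holds, NExp.var, NExp.eval, hbB] at hlt
    rw [block_cons_cons, block_singleton, runs_seq]
    refine (hstep _ _ hA' hlt hI rfl).mono ?_
    rintro s' t' ⟨ht', hx, hI'⟩
    rw [runs_setN]
    have e : (s'.setNat x 0 ((NExp.add (NExp.var x) (NExp.lit 1)).eval s')).nat x 0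
        = s.nat x 0 + 1 := by
      simp [State.setNat, NExp.eval, NExp.var, hx]
    have e' : (NExp.add (NExp.var x) (NExp.lit 1)).eval s' = s.nat x 0 + 1 := by
      simp [NExp.eval, NExp.var, hx]
    rw [e, e', Finset.sum_Ico_succ_top hA']
    simp only [BExp.cost, NExp.var, NExp.cost]
    refine ⟨⟨hI', by omega, by omega, by omega⟩, by omega⟩
  · rintro s' t ⟨t₀, ⟨hI, hA', hB', ht⟩, hlt, rfl⟩
    have hbB := hb _ _ hA' hB' hI rfl
    simp only [BExp.holds, NExp.var, NExp.eval, hbB] at hlt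
    have e : s'.nat x 0 = B := by omega
    rw [e] at hI ht
    refine ⟨hI, e, ?_⟩
    simp only [BExp.cost, NExp.var, NExp.cost]
    omega

theorem runs_forRange {x : ℕ} {a b : NExp} {p : Cmd} {s : State} (I : ℕ → State → Prop)
    (T A B : ℕ) (hA : a.eval s = A) (hAB : A ≤ B) (h₀ : I A (s.setNat x 0 A))
    (hb : ∀ i s, A ≤ i → i ≤ B → I i s → s.nat x 0 = i → b.eval s = B)
    (hstep : ∀ i s, A ≤ i → i < B → I i s → s.nat x 0 = i →
      Runs c p s fun s' t => t ≤ T ∧ s'.nat x 0 = i ∧ I (i + 1) (s'.setNat x 0 (i + 1))) :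
    Runs c (forRange x a b p) s fun s' t => I B s' ∧ s'.nat x 0 = B ∧
      t ≤ (B - A) * (T + b.cost + 10) + (a.cost + b.cost + 6) := by
  simpa using runs_forRange_sum I (fun _ => T) A B hA hAB h₀ hb hstep

/-! ### Arrays that a program does not change -/

/-- Names of the arrays of natural numbers that the program may write. -/
def Cmd.natWrites : Cmd → List ℕ
  | skip => []
  | storeN a _ _ => [a]
  | storeR _ _ _ => []
  | angleCost _ _ _ => []
  | seq p q => p.natWrites ++ q.natWrites
  | ite _ p q => p.natWrites ++ q.natWrites
  | loop _ p => p.natWrites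

/-- Names of the arrays of numbers that the program may write. -/
def Cmd.numWrites : Cmd → List ℕ
  | skip => []
  | storeN _ _ _ => []
  | storeR a _ _ => [a]
  | angleCost a _ _ => [a]
  | seq p q => p.numWrites ++ q.numWrites
  | ite _ p q => p.numWrites ++ q.numWrites
  | loop _ p => p.numWrites

theorem Exec.nat_eq {p : Cmd} {s s' : State} {t : ℕ} (h : Exec c p s s' t) {a : ℕ}
    (ha : a ∉ p.natWrites) : s'.nat a = s.nat a := by
  induction h with
  | storeN => simp_all [State.setNat, natWrites]
  | _ => simp_all [State.setNum, natWrites]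

theorem Exec.num_eq {p : Cmd} {s s' : State} {t : ℕ} (h : Exec c p s s' t) {a : ℕ}
    (ha : a ∉ p.numWrites) : s'.num a = s.num a := by
  induction h with
  | storeN => simp_all [State.setNat, numWrites]
  | _ => simp_all [State.setNum, numWrites]

/-- A run leaves the arrays alone that do not occur in its program as targets of assignments. -/
theorem Runs.frame {p : Cmd} {s : State} {Q : State → ℕ → Prop} (h : Runs c p s Q) :
    Runs c p s fun s' t => Q s' t ∧ (∀ a, a ∉ p.natWrites → s'.nat a = s.nat a) ∧
      ∀ a, a ∉ p.numWrites → s'.num a = s.num a := by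
  obtain ⟨s', t, h₁, h₂⟩ := h
  exact ⟨s', t, h₁, h₂, fun _ => h₁.nat_eq, fun _ => h₁.num_eq⟩

/-! ### Reading memory -/

@[simp] theorem State.setNat_nat (s : State) (a i x b j : ℕ) :
    (s.setNat a i x).nat b j = if b = a then if j = i then x else s.nat b j else s.nat b j := by
  unfold State.setNat
  by_cases h : b = a
  · subst h; simp [Function.update_apply]
  · simp [h]

@[simp] theorem State.setNat_nat_of_ne (s : State) {a b : ℕ} (i x : ℕ) (h : b ≠ a) :
    (s.setNat a i x).nat b = s.nat b := by
  simp [State.setNat, h]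

@[simp] theorem State.setNum_num_of_ne (s : State) {a b : ℕ} (i : ℕ) (x : EReal) (h : b ≠ a) :
    (s.setNum a i x).num b = s.num b := by
  simp [State.setNum, h]

@[simp] theorem State.setNat_num (s : State) (a i x : ℕ) : (s.setNat a i x).num = s.num := rfl

@[simp] theorem State.setNum_nat (s : State) (a i : ℕ) (x : EReal) :
    (s.setNum a i x).nat = s.nat := rfl

@[simp] theorem State.setNum_num (s : State) (a i : ℕ) (x : EReal) (b j : ℕ) :
    (s.setNum a i x).num b j = if b = a then if j = i then x else s.num b j else s.num b j := by
  unfold State.setNum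
  by_cases h : b = a
  · subst h; simp [Function.update_apply]
  · simp [h]

/-! ### Merge sort -/

section

attribute [local simp] NExp.eval NExp.cost NExp.var RExp.eval RExp.cost RExp.var BExp.holds BExp.cost
  runs_skip runs_storeN runs_storeR runs_setN runs_setR runs_seq runs_ite block_cons_cons
  block_singleton

/-- The length of the sorted runs. -/
abbrev sW : ℕ := 20
/-- The next position of the output of a merging pass. -/
abbrev sQ : ℕ := 21
/-- The next element of the left run. -/
abbrev sI : ℕ := 22
/-- The next element of the right run. -/
abbrev sJ : ℕ := 23
/-- The end of the left run and start of the right run. -/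
abbrev sMid : ℕ := 24
/-- The end of the right run. -/
abbrev sHi : ℕ := 25
/-- The output of a merging pass. -/
abbrev sTmp : ℕ := 26
/-- The number of keys, an input. -/
abbrev sN : ℕ := 27
/-- The sorted order, the output. -/
abbrev sOrd : ℕ := 28

attribute [local simp] sW sQ sI sJ sMid sHi sTmp sN sOrd

open NExp in
/-- One element is moved to `sTmp`. The two runs that are being merged are the cells from `sI` to
`sMid` and from `sJ` to `sHi`, cut off at `sN`; when they are used up, the next two are taken. -/
def mergeStep (key : ℕ) : Cmd :=
  block [
    Cmd.ite (BExp.nlt (var sQ) (var sHi)) skip (block [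
      setN sI (var sHi),
      setN sMid (add (var sHi) (var sW)),
      setN sJ (var sMid),
      setN sHi (add (var sMid) (var sW))]),
    Cmd.ite (BExp.and (BExp.and (BExp.nlt (var sI) (var sMid)) (BExp.nlt (var sI) (var sN)))
        (BExp.not (BExp.and (BExp.and (BExp.nlt (var sJ) (var sHi)) (BExp.nlt (var sJ) (var sN)))
          (BExp.rlt (RExp.get key (get sOrd (var sJ))) (RExp.get key (get sOrd (var sI)))))))
      (block [
        storeN sTmp (var sQ) (get sOrd (var sI)),
        setN sI (add (var sI) (lit 1))])
      (block [
        storeN sTmp (var sQ) (get sOrd (var sJ)),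
        setN sJ (add (var sJ) (lit 1))])]

open NExp in
/-- One pass of bottom-up merge sort: sorted runs of length `sW` are merged in pairs. -/
def mergePass (key : ℕ) : Cmd :=
  block [
    setN sI (lit 0),
    setN sMid (var sW),
    setN sJ (var sW),
    setN sHi (add (var sW) (var sW)),
    forRange sQ (lit 0) (var sN) (mergeStep key),
    forRange sQ (lit 0) (var sN) (storeN sOrd (var sQ) (get sTmp (var sQ)))]

open NExp in
/-- Write the indices `0, …, n - 1` to `sOrd` in increasing order of their keys, where `n` is the
value of `sN`. -/
def mergeSort (key : ℕ) : Cmd :=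
  block [
    forRange sQ (lit 0) (var sN) (storeN sOrd (var sQ) (var sQ)),
    setN sW (lit 1),
    loop (BExp.nlt (var sW) (var sN)) (block [
      mergePass key,
      setN sW (add (var sW) (var sW))])]

/-- The keys increase along `a` within each block of length `w` of the first `n` cells. -/
def SortedBlocks (n w : ℕ) (κ : ℕ → EReal) (a : ℕ → ℕ) : Prop :=
  ∀ x y, x ≤ y → y < n → x / w = y / w → κ (a x) ≤ κ (a y)

/-- The state of a merging pass from `a` to `t` after `q` steps: the runs `[lo, mid)` and `[mid, hi)`
are being merged, and their next elements are at `i` and `j`. The ends `mid` and `hi` may exceed the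
number `n` of elements. -/
structure Merging (n w : ℕ) (κ : ℕ → EReal) (a t : ℕ → ℕ) (lo mid hi q i j : ℕ) : Prop where
  dvd : w + w ∣ lo
  mid_eq : mid = lo + w
  hi_eq : hi = mid + w
  lo_le : lo ≤ i
  i_le : i ≤ mid
  mid_le : mid ≤ j
  j_le : j ≤ hi
  add_eq : i + j = q + mid
  i_le_n : i ≤ n
  j_le_n : j = mid ∨ j ≤ n
  sorted : SortedBlocks q (w + w) κ t
  le_left : ∀ x i', lo ≤ x → x < q → i ≤ i' → i' < mid → i' < n → κ (t x) ≤ κ (a i')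
  le_right : ∀ x j', lo ≤ x → x < q → j ≤ j' → j' < hi → j' < n → κ (t x) ≤ κ (a j')
  cover : ∀ x < n, (x < i ∨ mid ≤ x ∧ x < j) → ∃ y < q, t y = a x
  range : ∀ y < q, ∃ x < n, t y = a x

namespace Merging

variable {n w : ℕ} {κ : ℕ → EReal} {a t t' : ℕ → ℕ} {lo mid hi q i j : ℕ}

theorem init : Merging n w κ a t 0 w (w + w) 0 0 w where
  dvd := dvd_zero _
  mid_eq := by omega
  hi_eq := rfl
  lo_le := le_rfl
  i_le := by omega
  mid_le := le_rfl
  j_le := by omega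
  add_eq := rfl
  i_le_n := by omega
  j_le_n := Or.inl rfl
  sorted := fun _ _ _ h => by omega
  le_left := by intros; omega
  le_right := by intros; omega
  cover := by intros; omega
  range := by intros; omega

theorem next (h : Merging n w κ a t lo mid hi q i j) (hq : q < n) (hhi : hi ≤ q) :
    Merging n w κ a t hi (hi + w) (hi + w + w) q hi (hi + w) := by
  obtain ⟨h1, h2, h3, h4, h5, h6, h7, h8, h9, h10, h11, h12, h13, h14, h15⟩ := h
  refine ⟨?_, rfl, rfl, le_rfl, by omega, le_rfl, by omega, by omega, by omega, Or.inl rfl, h11,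
    by intros; omega, by intros; omega, ?_, h15⟩
  · rw [h3, h2, add_assoc]; exact (Nat.dvd_add_right h1).2 dvd_rfl
  · intro x hx hx'
    exact h14 x hx (by omega)

/-- Positions in the same block as the current output position do not precede the start of the
current pair of runs. -/
theorem le_of_div_eq (h : Merging n w κ a t lo mid hi q i j) (hq : q < hi) {x : ℕ}
    (hx : x / (w + w) = q / (w + w)) : lo ≤ x := by
  obtain ⟨b, rfl⟩ := h.dvd
  have h2 := h.mid_eq
  have h3 := h.hi_eq
  have h4 := h.lo_le
  have h5 := h.add_eq
  have h6 := h.mid_le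
  have h7 := h.i_le
  have hw : 0 < w + w := by omega
  have : q / (w + w) = b := by
    rw [Nat.div_eq_iff hw]
    constructor
    · rw [Nat.mul_comm]; omega
    · rw [Nat.mul_comm]; omega
  rw [this] at hx
  have := Nat.div_mul_le_self x (w + w)
  rw [hx, Nat.mul_comm] at this
  exact this

theorem sorted_snoc (h : Merging n w κ a t lo mid hi q i j) (hq : q < hi)
    (hsame : ∀ y < q, t' y = t y) (hv : ∀ x, lo ≤ x → x < q → κ (t x) ≤ κ (t' q)) :
    SortedBlocks (q + 1) (w + w) κ t' := by
  intro x y hxy hy hb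
  rcases Nat.lt_succ_iff_lt_or_eq.1 hy with hy | rfl
  · rw [hsame x (by omega), hsame y hy]
    exact h.sorted x y hxy hy hb
  · rcases hxy.lt_or_eq with hx | rfl
    · rw [hsame x hx]
      exact hv x (h.le_of_div_eq hq hb) hx
    · exact le_rfl

theorem left_lt (h : Merging n w κ a t lo mid hi q i j) (hq : q < hi) (hqn : q < n)
    (hr : ¬ (j < hi ∧ j < n)) : i < mid ∧ i < n := by
  obtain ⟨h1, h2, h3, h4, h5, h6, h7, h8, h9, h10, -⟩ := h
  omega

/-- The two runs that are being merged are sorted. -/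
theorem block_le (h : Merging n w κ a t lo mid hi q i j) (ha : SortedBlocks n w κ a) :
    (∀ x y, lo ≤ x → x ≤ y → y < mid → y < n → κ (a x) ≤ κ (a y)) ∧
      ∀ x y, mid ≤ x → x ≤ y → y < hi → y < n → κ (a x) ≤ κ (a y) := by
  obtain ⟨b, hb⟩ := h.dvd
  have h2 := h.mid_eq
  have h3 := h.hi_eq
  have key : ∀ d x, w * d ≤ x → x < w * d + w → x / w = d := by
    intro d x hx hx'
    rw [Nat.div_eq_iff (by omega), Nat.mul_comm]
    omega
  have e : lo = w * (2 * b) := by rw [hb]; ring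
  have e' : mid = w * (2 * b + 1) := by rw [h2, hb]; ring
  constructor
  · intro x y hx hxy hy hyn
    exact ha x y hxy hyn ((key (2 * b) x (by omega) (by omega)).trans
      (key (2 * b) y (by omega) (by omega)).symm)
  · intro x y hx hxy hy hyn
    exact ha x y hxy hyn ((key (2 * b + 1) x (by omega) (by omega)).trans
      (key (2 * b + 1) y (by omega) (by omega)).symm)

theorem takeLeft (h : Merging n w κ a t lo mid hi q i j) (ha : SortedBlocks n w κ a)
    (hq : q < hi) (hi' : i < mid) (hin : i < n)
    (hle : j < hi → j < n → κ (a i) ≤ κ (a j)) (ht : ∀ y, t' y = if y = q then a i else t y) :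
    Merging n w κ a t' lo mid hi (q + 1) (i + 1) j := by
  have hsame : ∀ y < q, t' y = t y := fun y hy => by rw [ht, if_neg (by omega)]
  have htq : t' q = a i := by rw [ht, if_pos rfl]
  have hblock := h.block_le ha
  have hs := h.sorted_snoc hq hsame (fun x hx hxq => by
    rw [htq]; exact h.le_left x i hx hxq le_rfl hi' hin)
  obtain ⟨h1, h2, h3, h4, h5, h6, h7, h8, h9, h10, h11, h12, h13, h14, h15⟩ := h
  refine ⟨h1, h2, h3, by omega, by omega, by omega, by omega, by omega, by omega, by omega, hs,
    ?_, ?_, ?_, ?_⟩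
  · intro x i' hx hxq hi'' him hin'
    rcases Nat.lt_succ_iff_lt_or_eq.1 hxq with hxq | rfl
    · rw [hsame x hxq]; exact h12 x i' hx hxq (by omega) him hin'
    · rw [htq]; exact hblock.1 i i' h4 (by omega) him hin'
  · intro x j' hx hxq hj' hjh hjn
    rcases Nat.lt_succ_iff_lt_or_eq.1 hxq with hxq | rfl
    · rw [hsame x hxq]; exact h13 x j' hx hxq (by omega) hjh hjn
    · rw [htq]
      exact (hle (by omega) (by omega)).trans (hblock.2 j j' h6 hj' hjh hjn)
  · intro x hx hx'
    by_cases hxi : x = i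
    · exact ⟨q, by omega, by rw [htq, hxi]⟩
    · obtain ⟨y, hy, hya⟩ := h14 x hx (by omega)
      exact ⟨y, by omega, by rw [hsame y hy, hya]⟩
  · intro y hy
    rcases Nat.lt_succ_iff_lt_or_eq.1 hy with hy | rfl
    · rw [hsame y hy]; exact h15 y hy
    · exact ⟨i, hin, htq⟩
theorem takeRight (h : Merging n w κ a t lo mid hi q i j) (ha : SortedBlocks n w κ a)
    (hq : q < hi) (hj : j < hi) (hjn : j < n)
    (hle : i < mid → i < n → κ (a j) ≤ κ (a i)) (ht : ∀ y, t' y = if y = q then a j else t y) :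
    Merging n w κ a t' lo mid hi (q + 1) i (j + 1) := by
  have hsame : ∀ y < q, t' y = t y := fun y hy => by rw [ht, if_neg (by omega)]
  have htq : t' q = a j := by rw [ht, if_pos rfl]
  have hblock := h.block_le ha
  have hs := h.sorted_snoc hq hsame (fun x hx hxq => by
    rw [htq]; exact h.le_right x j hx hxq le_rfl hj hjn)
  obtain ⟨h1, h2, h3, h4, h5, h6, h7, h8, h9, h10, h11, h12, h13, h14, h15⟩ := h
  refine ⟨h1, h2, h3, by omega, by omega, by omega, by omega, by omega, by omega, by omega, hs,
    ?_, ?_, ?_, ?_⟩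
  · intro x i' hx hxq hi'' him hin'
    rcases Nat.lt_succ_iff_lt_or_eq.1 hxq with hxq | rfl
    · rw [hsame x hxq]; exact h12 x i' hx hxq (by omega) him hin'
    · rw [htq]
      exact (hle (by omega) (by omega)).trans (hblock.1 i i' h4 hi'' him hin')
  · intro x j' hx hxq hj' hjh hjn
    rcases Nat.lt_succ_iff_lt_or_eq.1 hxq with hxq | rfl
    · rw [hsame x hxq]; exact h13 x j' hx hxq (by omega) hjh hjn
    · rw [htq]; exact hblock.2 j j' h6 (by omega) hjh hjn
  · intro x hx hx'
    by_cases hxj : x = j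
    · exact ⟨q, by omega, by rw [htq, hxj]⟩
    · obtain ⟨y, hy, hya⟩ := h14 x hx (by omega)
      exact ⟨y, by omega, by rw [hsame y hy, hya]⟩
  · intro y hy
    rcases Nat.lt_succ_iff_lt_or_eq.1 hy with hy | rfl
    · rw [hsame y hy]; exact h15 y hy
    · exact ⟨j, hjn, htq⟩

theorem cover_all (h : Merging n w κ a t lo mid hi n i j) : ∀ x < n, ∃ y < n, t y = a x := by
  obtain ⟨h1, h2, h3, h4, h5, h6, h7, h8, h9, h10, h11, h12, h13, h14, h15⟩ := h
  exact fun x hx => h14 x hx (by omega)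

end Merging

/-- The memory after `q` steps of a merging pass from the order `a`. -/
def MergeInv (n w key : ℕ) (κ : ℕ → EReal) (a : ℕ → ℕ) (q : ℕ) (s : State) : Prop :=
  s.num key = κ ∧ s.nat sN 0 = n ∧ s.nat sW 0 = w ∧ (∀ x, s.nat sOrd x = a x) ∧
    ∃ lo, Merging n w κ a (s.nat sTmp) lo (s.nat sMid 0) (s.nat sHi 0) q (s.nat sI 0) (s.nat sJ 0)

theorem runs_mergeStep {n w key : ℕ} {κ : ℕ → EReal} {a : ℕ → ℕ} {q : ℕ} {s : State}
    (ha : SortedBlocks n w κ a) (h : MergeInv n w key κ a q s) (hqs : s.nat sQ 0 = q)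
    (hq : q < n) (hw : 0 < w) :
    Runs c (mergeStep key) s fun s' t => t ≤ 100 ∧ s'.nat sQ 0 = q ∧
      MergeInv n w key κ a (q + 1) (s'.setNat sQ 0 (q + 1)) := by
  rw [mergeStep, block_cons_cons, block_singleton, runs_seq]
  have first : Runs c (Cmd.ite (BExp.nlt (NExp.var sQ) (NExp.var sHi)) skip (block [
      setN sI (NExp.var sHi),
      setN sMid (NExp.add (NExp.var sHi) (NExp.var sW)),
      setN sJ (NExp.var sMid),
      setN sHi (NExp.add (NExp.var sMid) (NExp.var sW))])) s fun s' t => t ≤ 30 ∧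
        s'.nat sQ 0 = q ∧ MergeInv n w key κ a q s' ∧ q < s'.nat sHi 0 := by
    obtain ⟨h1, h2, h3, h4, lo, h5⟩ := h
    simp only [runs_ite]
    constructor
    · intro hlt
      simp at hlt
      simp
      exact ⟨hqs, ⟨h1, h2, h3, h4, lo, h5⟩, by simpa [hqs] using hlt⟩
    · intro hlt
      simp at hlt
      have e : s.nat 25 0 = q := by
        have := h5.add_eq; have := h5.i_le; have := h5.j_le
        simp at *; omega
      have h6 := h5.next hq (by simp; omega)
      simp at h1 h2 h3 h4 h6 hqs
      simp [MergeInv, *]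
      rw [e] at h6
      exact ⟨⟨_, h6⟩, by omega⟩
  refine first.mono ?_
  rintro s₁ t₁ ⟨ht₁, hq₁, ⟨h1, h2, h3, h4, lo, h5⟩, hlt⟩
  simp only [runs_ite]
  constructor
  · intro hb
    simp [-not_and] at hb h1 h2 h3 h4 hlt hq₁ h5
    have h6 := h5.takeLeft (t' := fun y => if y = q then a (s₁.nat 22 0) else s₁.nat 26 y) ha hlt
      hb.1.1 (by omega) (fun h7 h8 => by
        by_contra h9
        refine hb.2 ⟨⟨h7, by omega⟩, ?_⟩
        rw [h4, h4, h1]; exact not_le.1 h9) (fun _ => rfl)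
    simp [MergeInv, *]
    refine ⟨by omega, lo, ?_⟩
    convert h6
    simp [State.setNat_nat, *]
  · intro hb
    simp [-not_and] at hb h1 h2 h3 h4 hlt hq₁ h5
    have hj : s₁.nat 23 0 < s₁.nat 25 0 ∧ s₁.nat 23 0 < n := by
      by_contra h7
      have h8 := h5.left_lt hlt hq h7
      refine hb ⟨⟨h8.1, by omega⟩, fun h9 => h7 ⟨h9.1.1, by omega⟩⟩
    have h6 := h5.takeRight (t' := fun y => if y = q then a (s₁.nat 23 0) else s₁.nat 26 y) ha hlt
      hj.1 hj.2 (fun h7 h8 => by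
        by_contra h9
        refine hb ⟨⟨h7, by omega⟩, fun h10 => h9 ?_⟩
        have h11 := h10.2
        rw [h4, h4, h1] at h11
        exact h11.le) (fun _ => rfl)
    simp [MergeInv, *]
    refine ⟨by omega, lo, ?_⟩
    convert h6
    simp [State.setNat_nat, *]

/-- The first `n` cells of `a` hold the numbers below `n`. -/
def Enumerates (n : ℕ) (a : ℕ → ℕ) : Prop :=
  (∀ x < n, a x < n) ∧ ∀ x < n, ∃ y < n, a y = x

theorem runs_mergePass {n w key : ℕ} {κ : ℕ → EReal} {a : ℕ → ℕ} {s : State}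
    (ha : SortedBlocks n w κ a) (hw : 0 < w) (hκ : s.num key = κ) (hn : s.nat sN 0 = n)
    (hws : s.nat sW 0 = w) (hord : ∀ x, s.nat sOrd x = a x) (he : Enumerates n a) :
    Runs c (mergePass key) s fun s' t => t ≤ n * 150 + 40 ∧ s'.num key = κ ∧ s'.nat sN 0 = n ∧
      s'.nat sW 0 = w ∧ SortedBlocks n (w + w) κ (s'.nat sOrd) ∧ Enumerates n (s'.nat sOrd) := by
  simp only [mergePass, block_cons_cons, block_singleton, runs_seq, runs_setN]
  refine (runs_forRange (MergeInv n w key κ a) 100 0 n rfl (Nat.zero_le _) ?_ ?_ ?_).mono ?_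
  · simp at *
    simp [MergeInv, *]
    exact ⟨0, Merging.init⟩
  · rintro i s - - ⟨-, h, -⟩ -
    simpa using h
  · rintro i s - hi hI hq
    exact runs_mergeStep ha hI hq hi hw
  rintro s₁ t₁ ⟨⟨h1, h2, h3, h4, lo, h5⟩, -, ht₁⟩
  refine (runs_forRange (fun q s => s.num key = κ ∧ s.nat sN 0 = n ∧ s.nat sW 0 = w ∧
    (∀ x, s.nat sTmp x = s₁.nat sTmp x) ∧ ∀ x < q, s.nat sOrd x = s₁.nat sTmp x)
    10 0 n rfl (Nat.zero_le _) ?_ ?_ ?_).mono ?_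
  · simp at *
    simp [*]
  · rintro i s - - ⟨-, h, -⟩ -
    simpa using h
  · rintro i s - hi ⟨g1, g2, g3, g4, g5⟩ hq
    simp at *
    simp [*]
    intro x hx
    split_ifs with h
    · rw [h]
    · exact g5 x (by omega)
  · rintro s₂ t₂ ⟨⟨g1, g2, g3, g4, g5⟩, -, ht₂⟩
    refine ⟨?_, g1, g2, g3, ?_, ?_, ?_⟩
    · simp at *; omega
    · intro x y hxy hy hb
      rw [g5 x (by omega), g5 y hy]
      exact h5.sorted x y hxy hy hb
    · intro x hx
      obtain ⟨y, hy, e⟩ := h5.range x hx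
      rw [g5 x hx, e]
      exact he.1 y hy
    · intro x hx
      obtain ⟨y, hy, e⟩ := he.2 x hx
      obtain ⟨z, hz, e'⟩ := h5.cover_all y hy
      exact ⟨z, hz, by rw [g5 z hz, e', e]⟩

theorem runs_mergeSort {n key : ℕ} {s : State} (hn : s.nat sN 0 = n) :
    Runs c (mergeSort key) s fun s' t => t ≤ (n * 150 + 60) * (Nat.clog 2 n + 1) ∧
      Enumerates n (s'.nat sOrd) ∧
      ∀ x y, x ≤ y → y < n → s.num key (s'.nat sOrd x) ≤ s.num key (s'.nat sOrd y) := by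
  simp only [mergeSort, block_cons_cons, block_singleton, runs_seq, runs_setN]
  refine (runs_forRange (fun q s' => s'.num key = s.num key ∧ s'.nat sN 0 = n ∧
    ∀ x < q, s'.nat sOrd x = x) 10 0 n rfl (Nat.zero_le _) ?_ ?_ ?_).mono ?_
  · simp at *
    simp [*]
  · rintro i s - - ⟨-, h, -⟩ -
    simpa using h
  · rintro i s' - hi ⟨h1, h2, h3⟩ hq
    simp at *
    simp [*]
    intro x hx
    split_ifs with h
    · exact h.symm
    · exact h3 x (by omega)
  rintro s₁ t₁ ⟨⟨h1, h2, h3⟩, -, ht₁⟩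
  -- after `e` passes the runs have length `2 ^ e`
  refine (runs_loop (fun s' t => s'.num key = s.num key ∧ s'.nat sN 0 = n ∧
    Enumerates n (s'.nat sOrd) ∧ SortedBlocks n (s'.nat sW 0) (s.num key) (s'.nat sOrd) ∧
    ∃ e, s'.nat sW 0 = 2 ^ e ∧ e ≤ Nat.clog 2 n ∧ t ≤ (n * 150 + 60) * e)
    (fun s' => n - s'.nat sW 0) ?_ ?_).mono ?_
  · simp at *
    simp [*]
    refine ⟨⟨fun x hx => ?_, fun x hx => ⟨x, hx, ?_⟩⟩, ?_, 0, rfl, Nat.zero_le _⟩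
    · simp [h3 x hx, hx]
    · simp [h3 x hx]
    · intro x y _ _ hb
      simp at hb
      rw [hb]
  · rintro s₂ t₂ ⟨g1, g2, g3, g4, e, g5, g6, g7⟩ hlt
    simp at hlt g2 g5
    rw [g2] at hlt
    have hpos : 0 < s₂.nat 20 0 := by rw [g5]; positivity
    simp only [runs_seq, runs_setN]
    refine (runs_mergePass g4 hpos g1 g2 rfl (fun _ => rfl) g3).mono ?_
    rintro s₃ t₃ ⟨k1, k2, k3, k4, k5, k6⟩
    simp at k2 k3 k4 k5 k6
    simp [k2, k3, k4]
    refine ⟨⟨k6, k5, e + 1, ?_, ?_, ?_⟩, ?_⟩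
    · rw [g5]; ring
    · rw [g5] at hlt
      by_contra hcon
      have : Nat.clog 2 n ≤ e := by omega
      have := (Nat.clog_le_iff_le_pow (by norm_num)).1 this
      omega
    · rw [mul_add, mul_one]; omega
    · omega
  · rintro s₂ t₂ ⟨t₀, ⟨g1, g2, g3, g4, e, g5, g6, g7⟩, hlt, rfl⟩
    simp at hlt g2 ht₁
    have := Nat.mul_le_mul_left (n * 150 + 60) g6
    refine ⟨?_, g3, fun x y hxy hy => g4 x y hxy hy ?_⟩
    · rw [mul_add, mul_one]; simp; omega
    · simp
      rw [Nat.div_eq_of_lt (by omega), Nat.div_eq_of_lt (by omega)]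

end

/-! ### Row minima of a totally monotone matrix -/

section

attribute [local simp] NExp.eval NExp.cost NExp.var RExp.eval RExp.cost RExp.var BExp.holds BExp.cost
  runs_skip runs_storeN runs_storeR runs_setN runs_setR runs_seq runs_ite block_cons_cons
  block_singleton sW sQ sI sJ sMid sHi sTmp sN sOrd nK nL rInDist rInDir rOutDir

/-- The row `r` minimizes the column `q` of the matrix `M` with rows `0, …, K - 1`. -/
def IsBestRow (K : ℕ) (M : ℕ → ℕ → EReal) (r q : ℕ) : Prop :=
  r < K ∧ ∀ r' < K, M r q ≤ M r' q

/-- A best row of a column is at least as good as every smaller row in all later columns, and at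
least as good as every larger row in all earlier columns. The columns are `1, …, l`. -/
structure BestRowsMonotone (K l : ℕ) (M : ℕ → ℕ → EReal) : Prop where
  later : ∀ r r' q q', IsBestRow K M r q → 0 < q → q ≤ q' → q' ≤ l → r' ≤ r → M r q' ≤ M r' q'
  earlier : ∀ r r' q q', IsBestRow K M r q → 0 < q' → q' ≤ q → q ≤ l → r ≤ r' → r' < K →
    M r q' ≤ M r' q'

/-- The best rows are known, and increase, at the columns that are divisible by the stride `S`. There
are two sentinels: the row `0` at column `0`, and the last row at the columns beyond `l`. -/
structure BestAtStride (K l S : ℕ) (M : ℕ → ℕ → EReal) (o : ℕ → ℕ) : Prop where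
  zero : o 0 = 0
  beyond : ∀ q, l < q → q ≤ 3 * l → o q = K - 1
  best : ∀ q, S ∣ q → 0 < q → q ≤ l → IsBestRow K M (o q) q
  mono : ∀ q, S ∣ q → q ≤ l → o q ≤ o (q + S)

/-- The state of the refinement from stride `2 * S` to stride `S` when the columns before `Q` are
done. -/
structure Refining (K l S : ℕ) (M : ℕ → ℕ → EReal) (o : ℕ → ℕ) (Q : ℕ) : Prop where
  zero : o 0 = 0
  beyond : ∀ q, l < q → q ≤ 3 * l → o q = K - 1
  best : ∀ q, S ∣ q → (q < Q ∨ S + S ∣ q) → 0 < q → q ≤ l → IsBestRow K M (o q) q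
  mono_even : ∀ q, S + S ∣ q → q ≤ l → o q ≤ o (q + (S + S))
  mono : ∀ q, S ∣ q → q + S < Q → q ≤ l → o q ≤ o (q + S)
  dvd : S + S ∣ Q + S
  le : S ≤ Q

namespace Refining

variable {K l S Q : ℕ} {M : ℕ → ℕ → EReal} {o o' : ℕ → ℕ}

theorem of_bestAtStride (h : BestAtStride K l (S + S) M o) : Refining K l S M o S where
  zero := h.zero
  beyond := h.beyond
  best := by
    intro q hS hq h0 hl
    rcases hq with hq | hq
    · have := Nat.le_of_dvd h0 hS; omega
    · exact h.best q hq h0 hl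
  mono_even := h.mono
  mono := by intros; omega
  dvd := dvd_rfl
  le := le_rfl

theorem dvd_right (h : Refining K l S M o Q) : S ∣ Q := by
  have : S ∣ Q + S := dvd_trans ⟨2, by ring⟩ h.dvd
  exact (Nat.dvd_add_left dvd_rfl).1 this

theorem not_dvd (h : Refining K l S M o Q) (hS : 0 < S) : ¬ S + S ∣ Q := by
  intro h'
  have := Nat.le_of_dvd hS ((Nat.dvd_add_right h').1 h.dvd)
  omega

theorem dvd_sub (h : Refining K l S M o Q) : S + S ∣ Q - S := by
  have h1 := h.le
  have h2 : S + S ∣ (Q - S) + (S + S) := by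
    rw [show Q - S + (S + S) = Q + S by omega]; exact h.dvd
  exact (Nat.dvd_add_left dvd_rfl).1 h2

theorem lt_of_le (h : Refining K l S M o Q) (hK : 0 < K) {q : ℕ} (hS : S + S ∣ q)
    (hq : q ≤ 3 * l) : o q < K := by
  rcases Nat.eq_zero_or_pos q with rfl | h0
  · rw [h.zero]; exact hK
  · by_cases hl : q ≤ l
    · exact (h.best q (dvd_trans ⟨2, by ring⟩ hS) (Or.inr hS) h0 hl).1
    · rw [h.beyond q (by omega) hq]; omega

theorem lo_le_hi (h : Refining K l S M o Q) (hQ : Q ≤ l) : o (Q - S) ≤ o (Q + S) := by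
  have := h.mono_even (Q - S) h.dvd_sub (by omega)
  have h1 := h.le
  rwa [show Q - S + (S + S) = Q + S by omega] at this

/-- A row that is best for column `Q` among those between the best rows of the two neighbouring
columns is best among all rows. -/
theorem isBestRow (h : Refining K l S M o Q) (hM : BestRowsMonotone K l M) (hS : 0 < S)
    (hSl : S ≤ l) (hQ : Q ≤ l) (hK : 0 < K) {r : ℕ} (hr₂ : r ≤ o (Q + S))
    (hr : ∀ r', o (Q - S) ≤ r' → r' ≤ o (Q + S) → M r Q ≤ M r' Q) : IsBestRow K M r Q := by
  have hSQ := h.le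
  have hlh := h.lo_le_hi hQ
  have hhi := h.lt_of_le hK h.dvd (by omega)
  refine ⟨by omega, fun r' hr' => ?_⟩
  by_cases h1 : r' < o (Q - S)
  · have h0 : 0 < Q - S := by
      by_contra h0
      rw [show Q - S = 0 by omega, h.zero] at h1
      omega
    refine (hr _ le_rfl hlh).trans (hM.later _ _ (Q - S) Q ?_ h0 (by omega) hQ h1.le)
    exact h.best _ (dvd_trans ⟨2, by ring⟩ h.dvd_sub) (Or.inl (by omega)) h0 (by omega)
  · by_cases h2 : o (Q + S) < r'
    · have hl : Q + S ≤ l := by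
        by_contra hl
        rw [h.beyond _ (by omega) (by omega)] at h2
        omega
      refine (hr _ hlh le_rfl).trans
        (hM.earlier _ _ (Q + S) Q ?_ (by omega) (by omega) hl h2.le hr')
      exact h.best _ (dvd_trans ⟨2, by ring⟩ h.dvd) (Or.inr h.dvd) (by omega) hl
    · exact hr r' (by omega) (by omega)

theorem step (h : Refining K l S M o Q) (hM : BestRowsMonotone K l M) (hS : 0 < S) (hSl : S ≤ l)
    (hQ : Q ≤ l) (hK : 0 < K) {r : ℕ} (hr₁ : o (Q - S) ≤ r) (hr₂ : r ≤ o (Q + S))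
    (hr : ∀ r', o (Q - S) ≤ r' → r' ≤ o (Q + S) → M r Q ≤ M r' Q)
    (ho : ∀ q, o' q = if q = Q then r else o q) : Refining K l S M o' (Q + (S + S)) := by
  have hbest := h.isBestRow hM hS hSl hQ hK hr₂ hr
  have hSQ := h.le
  have hdvd := h.dvd_right
  have hnd := h.not_dvd hS
  have hoQ : o' Q = r := by rw [ho, if_pos rfl]
  have hne : ∀ q, q ≠ Q → o' q = o q := fun q hq => by rw [ho, if_neg hq]
  -- consecutive multiples of `S` differ by `S`
  have hmul : ∀ q, S ∣ q → ∀ m, S ∣ m → q < m + S → q ≤ m := by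
    intro q hq m hm hlt
    obtain ⟨x, rfl⟩ := hq
    obtain ⟨y, rfl⟩ := hm
    have : x < y + 1 := by
      by_contra hcon
      have := Nat.mul_le_mul_left S (not_lt.1 hcon)
      rw [mul_add, mul_one] at this
      omega
    exact Nat.mul_le_mul_left S (by omega)
  refine ⟨?_, ?_, ?_, ?_, ?_, ?_, by omega⟩
  · rw [hne 0 (by omega)]; exact h.zero
  · intro q hq hq'
    rw [hne q (by omega)]; exact h.beyond q hq hq'
  · intro q hqS hq h0 hl
    by_cases e : q = Q
    · rw [e, hoQ]; exact hbest
    rw [hne q e]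
    refine h.best q hqS ?_ h0 hl
    rcases hq with hq | hq
    · by_cases hqQ : q < Q
      · exact Or.inl hqQ
      · right
        have h1 : q ≤ Q + S := hmul q hqS (Q + S) (dvd_add hdvd dvd_rfl) (by omega)
        have h2 : q = Q + S := by
          by_contra h3
          exact e (le_antisymm (hmul q hqS Q hdvd (by omega)) (by omega))
        rw [h2]; exact h.dvd
    · exact Or.inr hq
  · intro q hq hl
    rw [hne q (fun e => hnd (e ▸ hq)), hne _ (fun e => hnd (e ▸ dvd_add hq dvd_rfl))]
    exact h.mono_even q hq hl
  · intro q hqS hq hl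
    have h1 : q ≤ Q := hmul q hqS Q hdvd (by omega)
    rcases h1.lt_or_eq with h1 | rfl
    · have h2 : q + S ≤ Q := by
        have := hmul (q + S) (dvd_add hqS dvd_rfl) Q hdvd (by omega)
        exact this
      rcases h2.lt_or_eq with h2 | h2
      · rw [hne q (by omega), hne _ (by omega)]
        exact h.mono q hqS h2 hl
      · rw [hne q (by omega), h2, hoQ, show q = Q - S by omega]
        exact hr₁
    · rw [hoQ, hne _ (by omega)]
      exact hr₂
  · have := dvd_add h.dvd (dvd_refl (S + S))
    rwa [show Q + S + (S + S) = Q + (S + S) + S by ring] at this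

theorem bestAtStride (h : Refining K l S M o Q) (hSl : S ≤ l) (hQ : l < Q) :
    BestAtStride K l S M o where
  zero := h.zero
  beyond := h.beyond
  best q hS h0 hl := h.best q hS (Or.inl (by omega)) h0 hl
  mono := by
    intro q hS hl
    by_cases hq : q + S < Q
    · exact h.mono q hS hq hl
    · rw [h.beyond (q + S) (by omega) (by omega)]
      rcases Nat.eq_zero_or_pos q with rfl | h0
      · rw [h.zero]; exact Nat.zero_le _
      · have := (h.best q hS (Or.inl (by omega)) h0 hl).1
        omega

end Refining

/-- The best rows of the columns. -/
abbrev oBest : ℕ := 30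
/-- The stride. -/
abbrev oS : ℕ := 31
/-- The current column. -/
abbrev oQ : ℕ := 32
/-- The current row. -/
abbrev oR : ℕ := 33
/-- The first row to be searched. -/
abbrev oLo : ℕ := 34
/-- The last row to be searched. -/
abbrev oHi : ℕ := 35
/-- The best row so far. -/
abbrev oArg : ℕ := 36
/-- The rows in the order of their directions. -/
abbrev oRow : ℕ := 37
/-- The incoming edges that the rows represent, indexed by the rows before sorting. -/
abbrev oSrc : ℕ := 38
/-- The number of rows. -/
abbrev oK : ℕ := 39

/-- The directions of the rows, indexed by the rows before sorting. -/
abbrev xAng : ℕ := 20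
/-- The difference between the directions of a row and a column. -/
abbrev xDiff : ℕ := 21
/-- An entry of the matrix. -/
abbrev xVal : ℕ := 22
/-- The least entry so far. -/
abbrev xMin : ℕ := 23

attribute [local simp] oBest oS oQ oR oLo oHi oArg oRow oSrc oK xAng xDiff xVal xMin

/-- The memory represents the matrix `M`, with rows `0, …, K - 1` and columns `1, …, l`; the column `q`
belongs to the outgoing edge at position `q - 1` of the sorted order. An entry is infinite if the angles of row and column differ by more than 180 degrees. -/
def HoldsMatrix (c : ℝ → ℝ) (K l : ℕ) (M : ℕ → ℕ → EReal) (s : State) : Prop :=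
  ∀ r < K, ∀ q, 0 < q → q ≤ l → ∃ x : ℝ,
    s.num xAng (s.nat oRow r) - s.num rOutDir (s.nat sOrd (q - 1)) = (x : EReal) ∧
      M r q = if |x| ≤ 180 then ((c |x| : ℝ) : EReal) + s.num rInDist (s.nat oSrc (s.nat oRow r))
        else ⊤

open NExp in
/-- Evaluate the entry in the current row and column. -/
def evalEntry : Cmd :=
  block [
    setR xDiff (RExp.sub (RExp.get xAng (get oRow (var oR)))
      (RExp.get rOutDir (get sOrd (sub (var oQ) (lit 1))))),
    Cmd.ite (BExp.rlt (RExp.var xDiff) (RExp.lit 0))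
      (setR xDiff (RExp.sub (RExp.lit 0) (RExp.var xDiff))) skip,
    Cmd.ite (BExp.rlt (RExp.lit 180) (RExp.var xDiff)) (setR xVal RExp.infty) (block [
      angleCost xVal (lit 0) (RExp.var xDiff),
      setR xVal (RExp.add (RExp.var xVal) (RExp.get rInDist (get oSrc (get oRow (var oR)))))])]

open NExp in
/-- Search the rows from `oLo` to `oHi` for a best row of the current column. -/
def scanRows : Cmd :=
  block [
    setN oArg (var oLo),
    setR xMin RExp.infty,
    forRange oR (var oLo) (add (var oHi) (lit 1)) (block [
      evalEntry,
      Cmd.ite (BExp.rlt (RExp.var xVal) (RExp.var xMin))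
        (block [setR xMin (RExp.var xVal), setN oArg (var oR)]) skip]),
    storeN oBest (var oQ) (var oArg)]

open NExp in
/-- Refinement from the stride `2 * S` to the stride `S`. -/
def refineStride : Cmd :=
  block [
    setN oQ (var oS),
    loop (BExp.not (BExp.nlt (var nL) (var oQ))) (block [
      setN oLo (get oBest (sub (var oQ) (var oS))),
      setN oHi (get oBest (add (var oQ) (var oS))),
      scanRows,
      setN oQ (add (var oQ) (add (var oS) (var oS)))])]

open NExp in
/-- Find a best row of every column. -/
def bestRows : Cmd :=
  block [
    forRange oQ (lit 0) (add (add (add (var nL) (var nL)) (var nL)) (lit 1))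
      (storeN oBest (var oQ) (sub (var oK) (lit 1))),
    storeN oBest (lit 0) (lit 0),
    setN oS (lit 1),
    loop (BExp.not (BExp.nlt (var nL) (var oS))) (setN oS (add (var oS) (var oS))),
    loop (BExp.nlt (lit 1) (var oS)) (block [
      setN oS (half (var oS)),
      refineStride])]

variable {K l : ℕ} {M : ℕ → ℕ → EReal}

theorem runs_evalEntry {s : State} (hM : HoldsMatrix c K l M s) (hr : s.nat oR 0 < K)
    (h0 : 0 < s.nat oQ 0) (hl : s.nat oQ 0 ≤ l) :
    Runs c evalEntry s fun s' t => t ≤ 50 ∧ s'.num xVal 0 = M (s.nat oR 0) (s.nat oQ 0) ∧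
      s'.nat = s.nat ∧ ∀ a, a ≠ xDiff → a ≠ xVal → s'.num a = s.num a := by
  obtain ⟨x, hx, hMx⟩ := hM _ hr _ h0 hl
  rw [evalEntry]
  simp only [block_cons_cons, block_singleton, runs_seq, runs_setR]
  have abs_step : ∀ s₁ : State, s₁.nat = s.nat → (∀ a, a ≠ xDiff → s₁.num a = s.num a) →
      s₁.num xDiff 0 = (x : EReal) →
      Runs c (Cmd.ite (BExp.rlt (RExp.var xDiff) (RExp.lit 0))
        (setR xDiff (RExp.sub (RExp.lit 0) (RExp.var xDiff))) skip) s₁ fun s₂ t =>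
          t ≤ 15 ∧ s₂.nat = s.nat ∧ (∀ a, a ≠ xDiff → s₂.num a = s.num a) ∧
            s₂.num xDiff 0 = ((|x| : ℝ) : EReal) := by
    intro s₁ h1 h2 h3
    simp only [runs_ite, runs_setR, runs_skip]
    simp at h3
    constructor
    · intro hlt
      simp [h3] at hlt
      simp [h1, h3, abs_of_neg hlt]
      intro a ha; simp [ha]; exact h2 a ha
    · intro hlt
      simp [h3] at hlt
      simp [h1, h3, abs_of_nonneg hlt]
      exact h2
  refine (abs_step (s.setNum xDiff 0 _) rfl ?_ ?_).mono ?_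
  · intro a ha; simp at ha; simp [ha]
  · simp at hx
    simp [hx]
  rintro s₂ t₂ ⟨ht, h1, h2, h3⟩
  simp only [runs_ite]
  simp at h3
  constructor
  · intro hlt
    have hlt' : ¬ |x| ≤ 180 := by
      simp [h3] at hlt
      exact not_le.2 (by exact_mod_cast hlt)
    rw [if_neg hlt'] at hMx
    simp at hMx
    simp [hMx, h1]
    refine ⟨by omega, fun a h4 h5 => ?_⟩
    simp [h5]; exact h2 a h4
  · intro hlt
    have hlt' : |x| ≤ 180 := by
      simp [h3] at hlt
      exact_mod_cast hlt
    rw [if_pos hlt'] at hMx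
    rw [runs_seq]
    refine runs_angleCost |x| ⟨abs_nonneg x, hlt'⟩ (by simp [h3]) ?_
    simp at hMx
    have e : s₂.num 0 = s.num 0 := h2 0 (by simp)
    simp [hMx, h1, e]
    refine ⟨by omega, fun a h4 h5 => ?_⟩
    simp [h5]; exact h2 a h4

theorem runs_scanRows {s : State} {q lo hi : ℕ} (hM : HoldsMatrix c K l M s) (hq : s.nat oQ 0 = q)
    (h0 : 0 < q) (hl : q ≤ l) (hlo : s.nat oLo 0 = lo) (hhi : s.nat oHi 0 = hi) (hlh : lo ≤ hi)
    (hK : hi < K) :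
    Runs c scanRows s fun s' t => t ≤ (hi + 1 - lo) * 100 + 40 ∧ ∃ r, lo ≤ r ∧ r ≤ hi ∧
      (∀ r', lo ≤ r' → r' ≤ hi → M r q ≤ M r' q) ∧
        ∀ q', s'.nat oBest q' = if q' = q then r else s.nat oBest q' := by
  rw [scanRows]
  simp only [block_cons_cons, block_singleton, runs_seq, runs_setR, runs_setN, runs_storeN]
  refine (runs_forRange (fun r s' => HoldsMatrix c K l M s' ∧ s'.nat oQ 0 = q ∧ s'.nat oHi 0 = hi ∧
    s'.nat oBest = s.nat oBest ∧ lo ≤ s'.nat oArg 0 ∧ s'.nat oArg 0 ≤ hi ∧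
    M (s'.nat oArg 0) q ≤ s'.num xMin 0 ∧ ∀ r', lo ≤ r' → r' < r → s'.num xMin 0 ≤ M r' q)
    80 lo (hi + 1) ?_ (by omega) ?_ ?_ ?_).mono ?_
  · simpa using hlo
  · simp at hlo hhi hq
    simp [hlo, hhi, hq, HoldsMatrix]
    refine ⟨by simpa [HoldsMatrix] using hM, hlh, fun r' h1 h2 => by omega⟩
  · rintro i s - - ⟨-, -, h, -⟩ -
    simpa using h
  · rintro r s₁ hr hrhi ⟨h1, h2, h3, h4, h5, h6, h7, h8⟩ h9
    rw [runs_seq]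
    refine (runs_evalEntry h1 (by omega) (by omega) (by omega)).mono ?_
    rintro s₂ t₂ ⟨ht, hv, hnat, hnum⟩
    have e0 : s₂.num 0 = s₁.num 0 := hnum 0 (by simp) (by simp)
    have e2 : s₂.num 2 = s₁.num 2 := hnum 2 (by simp) (by simp)
    have e20 : s₂.num 20 = s₁.num 20 := hnum 20 (by simp) (by simp)
    have e23 : s₂.num 23 = s₁.num 23 := hnum 23 (by simp) (by simp)
    have h1' : HoldsMatrix c K l M s₂ := by
      simpa [HoldsMatrix, hnat, e0, e2, e20] using h1
    rw [h9, h2] at hv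
    simp [HoldsMatrix] at h1' h2 h3 h4 h5 h6 h7 h8 h9 hv
    simp only [runs_ite]
    constructor
    · intro hlt
      simp [hv, e23] at hlt
      simp [HoldsMatrix, *]
      refine ⟨by omega, ?_, by omega, ?_⟩
      · simpa [hnat, h9, e0, e2, e20] using h1'
      · intro r' g1 g2
        rcases g2.lt_or_eq with g3 | rfl
        · exact hlt.le.trans (h8 r' g1 g3)
        · exact le_rfl
    · intro hlt
      simp [hv, e23] at hlt
      simp [HoldsMatrix, *]
      refine ⟨by omega, ?_, ?_⟩
      · simpa [hnat, h9, e0, e2, e20] using h1'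
      · intro r' g1 g2
        rcases g2.lt_or_eq with g3 | rfl
        · exact h8 r' g1 g3
        · exact hlt
  · rintro s₁ t₁ ⟨⟨h1, h2, h3, h4, h5, h6, h7, h8⟩, h9, ht⟩
    refine ⟨?_, s₁.nat oArg 0, h5, h6, fun r' g1 g2 => h7.trans (h8 r' g1 (by omega)), ?_⟩
    · simp at ht ⊢; omega
    · intro q'
      simp at h2 h4
      simp [h2, h4]

theorem runs_refineStride {s : State} {S : ℕ} (hMat : HoldsMatrix c K l M s)
    (hM : BestRowsMonotone K l M) (hL : s.nat nL 0 = l) (hS : s.nat oS 0 = S) (h0 : 0 < S)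
    (hSl : S ≤ l) (hK : 0 < K) (h : BestAtStride K l (S + S) M (s.nat oBest)) :
    Runs c refineStride s fun s' t => t ≤ (K + 3 * l) * 300 + 20 ∧
      BestAtStride K l S M (s'.nat oBest) ∧ s'.nat oS 0 = S ∧ s'.nat nL 0 = l ∧
        HoldsMatrix c K l M s' := by
  rw [refineStride]
  simp only [block_cons_cons, block_singleton, runs_seq, runs_setN]
  -- the operations are paid for by the advance of the current column and of the first row to search
  refine (runs_loop (fun s' t => HoldsMatrix c K l M s' ∧ s'.nat nL 0 = l ∧ s'.nat oS 0 = S ∧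
    Refining K l S M (s'.nat oBest) (s'.nat oQ 0) ∧ s'.nat oQ 0 ≤ l + (S + S) ∧
    t ≤ (s'.nat oBest (s'.nat oQ 0 - S) + s'.nat oQ 0) * 300) (fun s' => l + 1 - s'.nat oQ 0)
    ?_ ?_).mono ?_
  · simp [HoldsMatrix] at hMat hL hS h
    simp [HoldsMatrix, *]
    exact ⟨hMat, .of_bestAtStride h, by omega⟩
  · rintro s₁ t₁ ⟨h1, h2, h3, h4, h5, h6⟩ hb
    have hQ : s₁.nat oQ 0 ≤ l := by simp at hb h2 ⊢; omega
    simp only [runs_seq, runs_setN]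
    refine ((runs_scanRows (q := s₁.nat oQ 0) (lo := s₁.nat oBest (s₁.nat oQ 0 - S))
      (hi := s₁.nat oBest (s₁.nat oQ 0 + S)) (K := K) (l := l) (M := M) ?_ ?_ ?_ hQ ?_ ?_ ?_
      ?_).frame).mono ?_
    · simpa [HoldsMatrix] using h1
    · simp
    · have := h4.le; omega
    · simp at h3; simp [h3]
    · simp at h3; simp [h3]
    · exact h4.lo_le_hi hQ
    · exact h4.lt_of_le hK h4.dvd (by omega)
    rintro s₂ t₂ ⟨⟨ht, r, hr1, hr2, hr3, hr4⟩, hnat, hnum⟩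
    have e0 : s₂.num 0 = s₁.num 0 := (hnum 0 (by decide)).trans (by simp)
    have e2 : s₂.num 2 = s₁.num 2 := (hnum 2 (by decide)).trans (by simp)
    have e20 : s₂.num 20 = s₁.num 20 := (hnum 20 (by decide)).trans (by simp)
    have f1 : s₂.nat 1 = s₁.nat 1 := (hnat 1 (by decide)).trans (by simp)
    have f37 : s₂.nat 37 = s₁.nat 37 := (hnat 37 (by decide)).trans (by simp)
    have f38 : s₂.nat 38 = s₁.nat 38 := (hnat 38 (by decide)).trans (by simp)
    have f31 : s₂.nat 31 = s₁.nat 31 := (hnat 31 (by decide)).trans (by simp)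
    have f28 : s₂.nat 28 = s₁.nat 28 := (hnat 28 (by decide)).trans (by simp)
    have f32 : s₂.nat 32 = s₁.nat 32 := (hnat 32 (by decide)).trans (by simp)
    have hlh := h4.lo_le_hi hQ
    have hSQ := h4.le
    have h7 := h4.step hM h0 hSl hQ hK hr1 hr2 hr3 (o' := s₂.nat oBest)
      (fun q => by rw [hr4]; simp)
    have h8 := hr4 (s₁.nat oQ 0 + S)
    rw [if_neg (by omega)] at h8
    simp [HoldsMatrix] at h1 h2 h3 h5 h6 h7 h8 ht hQ hlh hSQ
    simp [HoldsMatrix, e0, e2, e20, f1, f37, f38, f31, f28, f32, h2, h3]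
    -- the last row searched in this column is the first one to search in the next column
    rw [show s₁.nat 32 0 + (S + S) - S = s₁.nat 32 0 + S by omega, h8]
    refine ⟨⟨h1, h7, by omega, ?_⟩, by omega⟩
    omega
  · rintro s₁ t₁ ⟨t₀, ⟨h1, h2, h3, h4, h5, h6⟩, hb, rfl⟩
    have hQ : l < s₁.nat oQ 0 := by simp at hb h2 ⊢; omega
    have := h4.lt_of_le hK h4.dvd_sub (by omega)
    refine ⟨?_, h4.bestAtStride hSl hQ, h3, h2, h1⟩
    simp at *
    omega

theorem runs_bestRows {s : State} (hMat : HoldsMatrix c K l M s)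
    (hM : BestRowsMonotone K l M) (hL : s.nat nL 0 = l) (hKs : s.nat oK 0 = K) (hK : 0 < K)
    (hl : 0 < l) :
    Runs c bestRows s fun s' t => t ≤ ((K + 3 * l) * 300 + 100) * (Nat.log 2 l + 2) ∧
      ∀ q, 0 < q → q ≤ l → IsBestRow K M (s'.nat oBest q) q := by
  rw [bestRows]
  simp only [block_cons_cons, block_singleton, runs_seq, runs_setN, runs_storeN]
  refine (runs_forRange (fun i s' => HoldsMatrix c K l M s' ∧ s'.nat nL 0 = l ∧ s'.nat oK 0 = K ∧
    ∀ q < i, s'.nat oBest q = K - 1) 20 0 (3 * l + 1) rfl (by omega) ?_ ?_ ?_).mono ?_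
  · simp [HoldsMatrix] at hMat hL hKs
    simp [HoldsMatrix, *]
    exact hMat
  · rintro i s - - ⟨-, h, -⟩ -
    simp at h; simp [h]; omega
  · rintro i s₁ - hi ⟨h1, h2, h3, h4⟩ hq
    simp [HoldsMatrix] at h1 h2 h3 h4 hq
    simp [HoldsMatrix, *]
    refine ⟨h1, fun q hq => ?_⟩
    intro h
    exact h4 q (by omega)
  rintro s₁ t₁ ⟨⟨h1, h2, h3, h4⟩, -, ht₁⟩
  refine (runs_loop (fun s' t => HoldsMatrix c K l M s' ∧ s'.nat nL 0 = l ∧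
    (∀ q, s'.nat oBest q = if q = 0 then 0 else s₁.nat oBest q) ∧
    ∃ e, s'.nat oS 0 = 2 ^ e ∧ 2 ^ e ≤ 2 * l ∧ t ≤ e * 20) (fun s' => 2 * l - s'.nat oS 0)
    ?_ ?_).mono ?_
  · simp [HoldsMatrix] at h1 h2
    simp [HoldsMatrix, *]
    exact ⟨h1, 0, by simp, by omega⟩
  · rintro s₂ t₂ ⟨g1, g2, g3, e, g4, g5, g6⟩ hb
    simp [HoldsMatrix] at g1 g2 g3 g4 hb
    rw [runs_setN]
    simp [HoldsMatrix, g2, g3, g4]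
    have h2e : 0 < 2 ^ e := by positivity
    refine ⟨⟨g1, e + 1, by ring, by rw [pow_succ]; omega, by omega⟩, by omega⟩
  rintro s₂ t₂ ⟨t₀, ⟨g1, g2, g3, e₀, g4, g5, g6⟩, hb₂, ht₂⟩
  have hlt : l < 2 ^ e₀ := by simp at hb₂ g2 g4; omega
  refine (runs_loop (fun s' t => HoldsMatrix c K l M s' ∧ s'.nat nL 0 = l ∧
    ∃ e ≤ e₀, s'.nat oS 0 = 2 ^ e ∧ BestAtStride K l (2 ^ e) M (s'.nat oBest) ∧
      t ≤ (e₀ - e) * ((K + 3 * l) * 300 + 50)) (fun s' => s'.nat oS 0) ?_ ?_).mono ?_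
  · refine ⟨g1, g2, e₀, le_rfl, g4, ⟨?_, ?_, ?_, ?_⟩, Nat.zero_le _⟩
    · rw [g3, if_pos rfl]
    · intro q hq hq'
      rw [g3, if_neg (by omega), h4 q (by omega)]
    · intro q hq hq0 hql
      have := Nat.le_of_dvd hq0 hq; omega
    · intro q hq hql
      have : q = 0 := by
        by_contra hq0
        have := Nat.le_of_dvd (by omega) hq; omega
      subst this
      rw [g3, if_pos rfl]; exact Nat.zero_le _
  · rintro s₃ t₃ ⟨k1, k2, e, he, k3, k4, k5⟩ hb
    obtain ⟨e, rfl⟩ : ∃ d, e = d + 1 := by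
      refine ⟨e - 1, ?_⟩
      rcases Nat.eq_zero_or_pos e with rfl | h
      · simp at hb k3; omega
      · omega
    have h2e : 0 < 2 ^ e := by positivity
    have hle : 2 ^ (e + 1) ≤ 2 ^ e₀ := Nat.pow_le_pow_right (by norm_num) he
    rw [pow_succ, mul_two] at k3 k4 hle
    have hhalf : (2 ^ e + 2 ^ e) / 2 = 2 ^ e := by omega
    simp only [runs_seq, runs_setN]
    refine (runs_refineStride (S := 2 ^ e) (K := K) (l := l) (M := M) ?_ hM ?_ ?_ h2e (by omega) hK
      ?_).mono ?_
    · simpa [HoldsMatrix] using k1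
    · simpa using k2
    · simp at k3; simp [k3, hhalf]
    · simpa using k4
    rintro s₄ t₄ ⟨m1, m2, m3, m4, m5⟩
    refine ⟨⟨m5, m4, e, by omega, m3, m2, ?_⟩, by omega⟩
    simp
    have : e₀ - e = (e₀ - (e + 1)) + 1 := by omega
    rw [this, add_mul, one_mul]
    omega
  · rintro s₃ t₃ ⟨t₀, ⟨k1, k2, e, he, k3, k4, k5⟩, hb, rfl⟩
    have he0 : e = 0 := by
      by_contra h
      have : 2 ^ 1 ≤ 2 ^ e := Nat.pow_le_pow_right (by norm_num) (by omega)
      simp at hb k3; omega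
    subst he0
    refine ⟨?_, fun q hq hql => k4.best q (by simp) hq hql⟩
    have hlog : e₀ ≤ Nat.log 2 l + 1 := by
      rcases Nat.eq_zero_or_pos e₀ with rfl | hpos
      · omega
      · obtain ⟨d, rfl⟩ : ∃ d, e₀ = d + 1 := ⟨e₀ - 1, by omega⟩
        have : 2 ^ d ≤ l := by rw [pow_succ] at g5; omega
        have := (Nat.le_log_iff_pow_le (by norm_num) (by omega)).2 this
        omega
    have hm := Nat.mul_le_mul_right ((K + 3 * l) * 300 + 50) hlog
    have e1 : ((K + 3 * l) * 300 + 100) * (Nat.log 2 l + 2)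
      = (Nat.log 2 l + 1) * ((K + 3 * l) * 300 + 50) + (Nat.log 2 l + 1) * 50
        + ((K + 3 * l) * 300 + 100) := by ring
    rw [e1]
    simp at ht₁ ht₂ k5 ⊢
    omega

end

/-! ### Crossing of translated angle cost functions -/

/-- The angle cost of angles between -180 and 180 degrees is a convex function. -/
theorem convexOn_comp_abs (hc : ConvexOn ℝ (Set.Icc 0 180) c) (hm : MonotoneOn c (Set.Icc 0 180)) :
    ConvexOn ℝ (Set.Icc (-180) 180) fun x => c |x| := by
  have himg : (fun x : ℝ => |x|) '' Set.Icc (-180) 180 = Set.Icc (0 : ℝ) 180 := by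
    ext y
    constructor
    · rintro ⟨x, hx, rfl⟩
      exact ⟨abs_nonneg x, abs_le.2 hx⟩
    · rintro ⟨h0, h1⟩
      exact ⟨y, ⟨by linarith, h1⟩, abs_of_nonneg h0⟩
  refine ConvexOn.comp (g := c) (f := fun x : ℝ => |x|) (himg ▸ hc) ?_ (himg ▸ hm)
  exact (convexOn_norm (convex_Icc (-180 : ℝ) 180))

/-- For a convex function, moving two points towards each other decreases the sum of the values. -/
theorem convexOn_add_le_add {S : Set ℝ} {h : ℝ → ℝ} (hh : ConvexOn ℝ S h)
    {x₀ x₁ x₂ x₃ : ℝ} (h0 : x₀ ∈ S) (h3 : x₃ ∈ S) (h01 : x₀ ≤ x₁) (h02 : x₀ ≤ x₂)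
    (hsum : x₁ + x₂ = x₀ + x₃) : h x₁ + h x₂ ≤ h x₀ + h x₃ := by
  rcases eq_or_lt_of_le (show x₀ ≤ x₃ by linarith) with e | hlt
  · have e1 : x₁ = x₀ := by linarith
    have e2 : x₂ = x₃ := by linarith
    rw [e1, e2]
  · have hd : x₃ - x₀ ≠ 0 := by linarith
    set u := (x₁ - x₀) / (x₃ - x₀)
    have hu0 : 0 ≤ u := div_nonneg (by linarith) (by linarith)
    have hu1 : u ≤ 1 := (div_le_one (by linarith)).2 (by linarith)
    have hux : u * (x₃ - x₀) = x₁ - x₀ := div_mul_cancel₀ _ hd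
    have i1 := hh.2 h0 h3 (sub_nonneg.2 hu1) hu0 (by ring)
    have i2 := hh.2 h0 h3 hu0 (sub_nonneg.2 hu1) (by ring)
    simp only [smul_eq_mul] at i1 i2
    rw [show (1 - u) * x₀ + u * x₃ = x₁ by linarith] at i1
    rw [show u * x₀ + (1 - u) * x₃ = x₂ by linarith] at i2
    linarith

/-- The distance obtained in direction `b` from a predecessor with distance `d` and direction `a`;
it is infinite if the directions, which are not reduced modulo 360, differ by more than 180
degrees. -/
noncomputable def entry (c : ℝ → ℝ) (a : ℝ) (d : EReal) (b : ℝ) : EReal :=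
  if |a - b| ≤ 180 then ((c |a - b| : ℝ) : EReal) + d else ⊤

theorem entry_neg (a : ℝ) (d : EReal) (b : ℝ) : entry c (-a) d (-b) = entry c a d b := by
  rw [entry, entry, show -a - -b = -(a - b) by ring, abs_neg]

theorem entry_ne_top {a : ℝ} {d : EReal} {b : ℝ} (hd : d ≠ ⊥) (h : entry c a d b ≠ ⊤) :
    |a - b| ≤ 180 ∧ ∃ x : ℝ, d = x := by
  unfold entry at h
  split_ifs at h with hab
  · refine ⟨hab, d.toReal, (EReal.coe_toReal ?_ hd).symm⟩
    rintro rfl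
    simp at h
  · exact absurd rfl h

/-- Once the predecessor with the larger direction is at least as good, it remains so in all larger
directions. -/
theorem entry_le_of_le (hc : ConvexOn ℝ (Set.Icc 0 180) c) (hm : MonotoneOn c (Set.Icc 0 180))
    {a₁ a₂ b₁ b₂ : ℝ} {d₁ d₂ : EReal} (ha : a₁ ≤ a₂) (hb : b₁ ≤ b₂) (hd₁ : d₁ ≠ ⊥) (hd₂ : d₂ ≠ ⊥)
    (h : entry c a₂ d₂ b₁ ≤ entry c a₁ d₁ b₁) (htop : entry c a₂ d₂ b₁ ≠ ⊤) :
    entry c a₂ d₂ b₂ ≤ entry c a₁ d₁ b₂ := by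
  by_cases htop' : entry c a₁ d₁ b₂ = ⊤
  · rw [htop']; exact le_top
  -- the two finite entries bound all four differences of directions by 180 degrees
  obtain ⟨h21, x₂, rfl⟩ := entry_ne_top hd₂ htop
  obtain ⟨h12, x₁, rfl⟩ := entry_ne_top hd₁ htop'
  have g21 := abs_le.1 h21
  have g12 := abs_le.1 h12
  have h11 : |a₁ - b₁| ≤ 180 := abs_le.2 ⟨by linarith, by linarith⟩
  have h22 : |a₂ - b₂| ≤ 180 := abs_le.2 ⟨by linarith, by linarith⟩
  rw [entry, entry, if_pos h21, if_pos h11] at h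
  rw [entry, entry, if_pos h22, if_pos h12]
  have key := convexOn_add_le_add (convexOn_comp_abs hc hm) (x₁ := a₁ - b₁)
    (x₂ := a₂ - b₂) (x₀ := a₁ - b₂) (x₃ := a₂ - b₁) ⟨g12.1, g12.2⟩ ⟨g21.1, g21.2⟩ (by linarith)
    (by linarith) (by ring)
  have h' : c |a₂ - b₁| + x₂ ≤ c |a₁ - b₁| + x₁ := by exact_mod_cast h
  have : c |a₂ - b₂| + x₂ ≤ c |a₁ - b₂| + x₁ := by linarith
  exact_mod_cast this

/-- Once the predecessor with the smaller direction is at least as good, it remains so in all smaller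
directions. -/
theorem entry_le_of_ge (hc : ConvexOn ℝ (Set.Icc 0 180) c) (hm : MonotoneOn c (Set.Icc 0 180))
    {a₁ a₂ b₁ b₂ : ℝ} {d₁ d₂ : EReal} (ha : a₁ ≤ a₂) (hb : b₁ ≤ b₂) (hd₁ : d₁ ≠ ⊥) (hd₂ : d₂ ≠ ⊥)
    (h : entry c a₁ d₁ b₂ ≤ entry c a₂ d₂ b₂) (htop : entry c a₁ d₁ b₂ ≠ ⊤) :
    entry c a₁ d₁ b₁ ≤ entry c a₂ d₂ b₁ := by
  rw [← entry_neg, ← entry_neg a₂] at h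
  rw [← entry_neg] at htop
  rw [← entry_neg, ← entry_neg a₂]
  exact entry_le_of_le hc hm (neg_le_neg ha) (neg_le_neg hb) hd₂ hd₁ h htop

/-- The hypothesis `hfin` excludes columns without a finite entry, in which every row is best; they are
harmless only if no distance is finite. -/
theorem bestRowsMonotone_entry {K l : ℕ} (hc : ConvexOn ℝ (Set.Icc 0 180) c)
    (hm : MonotoneOn c (Set.Icc 0 180)) {A B : ℕ → ℝ} {d : ℕ → EReal}
    (hA : ∀ r r', r ≤ r' → r' < K → A r ≤ A r')
    (hB : ∀ q q', 0 < q → q ≤ q' → q' ≤ l → B q ≤ B q') (hd : ∀ r < K, d r ≠ ⊥)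
    (hfin : (∃ r < K, d r ≠ ⊤) → ∀ q, 0 < q → q ≤ l → ∃ r < K, entry c (A r) (d r) (B q) ≠ ⊤) :
    BestRowsMonotone K l fun r q => entry c (A r) (d r) (B q) := by
  have main : ∀ r q, IsBestRow K (fun r q => entry c (A r) (d r) (B q)) r q → 0 < q → q ≤ l →
      (∀ r < K, d r = ⊤) ∨ entry c (A r) (d r) (B q) ≠ ⊤ := by
    intro r q h h0 hl
    by_cases hfd : ∃ r < K, d r ≠ ⊤
    · right
      obtain ⟨r', hr', hne⟩ := hfin hfd q h0 hl
      intro htop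
      have := h.2 r' hr'
      simp only [htop, top_le_iff] at this
      exact hne this
    · left
      push Not at hfd
      exact hfd
  have htop : ∀ a b, entry c a ⊤ b = ⊤ := by
    intro a b
    unfold entry
    split_ifs
    · simp
    · rfl
  constructor
  · intro r r' q q' h h0 hq hl hr
    rcases main r q h h0 (by omega) with h1 | h1
    · simp only [h1 r' (hr.trans_lt h.1), htop]; exact le_top
    · exact entry_le_of_le hc hm (hA _ _ hr h.1) (hB _ _ h0 hq hl) (hd _ (hr.trans_lt h.1))
        (hd _ h.1) (h.2 r' (hr.trans_lt h.1)) h1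
  · intro r r' q q' h h0 hq hl hr hr'
    rcases main r q h (by omega) hl with h1 | h1
    · simp only [h1 r' hr', htop]; exact le_top
    · exact entry_le_of_ge hc hm (hA _ _ hr hr') (hB _ _ h0 hq hl) (hd _ h.1) (hd _ hr')
        (h.2 r' hr') h1

/-! ### Angles modulo 360 degrees -/

theorem angle_mem {a b : ℝ} (ha : a ∈ Set.Ico (0 : ℝ) 360) (hb : b ∈ Set.Ico (0 : ℝ) 360) :
    angle (a - b) ∈ Set.Icc (0 : ℝ) 180 := by
  unfold angle
  obtain ⟨h1, h2⟩ := ha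
  obtain ⟨h3, h4⟩ := hb
  have h5 : |a - b| ≤ 360 := abs_le.2 ⟨by linarith, by linarith⟩
  refine ⟨le_min (abs_nonneg _) (by linarith), ?_⟩
  by_cases h : |a - b| ≤ 180
  · exact (min_le_left _ _).trans h
  · exact (min_le_right _ _).trans (by linarith)

/-- A lift of `a` that is within 180 degrees of `b` realizes the smaller angle between `a` and `b`. -/
theorem abs_lift_eq_angle {a b z : ℝ} (ha : a ∈ Set.Ico (0 : ℝ) 360) (hb : b ∈ Set.Ico (0 : ℝ) 360)
    (hz : z = -360 ∨ z = 0 ∨ z = 360) (h : |a + z - b| ≤ 180) : |a + z - b| = angle (a - b) := by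
  obtain ⟨h1, h2⟩ := ha
  obtain ⟨h3, h4⟩ := hb
  have h5 := abs_le.1 h
  unfold angle
  rcases hz with rfl | rfl | rfl
  · rw [abs_of_nonpos (show a + -360 - b ≤ 0 by linarith),
      abs_of_nonneg (show 0 ≤ a - b by linarith), min_eq_right (by linarith)]
    ring
  · rw [add_zero] at h ⊢
    rw [min_eq_left (by linarith)]
  · rw [abs_of_nonneg (show 0 ≤ a + 360 - b by linarith),
      abs_of_nonpos (show a - b ≤ 0 by linarith), min_eq_right (by linarith)]
    ring

theorem exists_lift {a b : ℝ} (ha : a ∈ Set.Ico (0 : ℝ) 360) (hb : b ∈ Set.Ico (0 : ℝ) 360) :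
    ∃ z : ℝ, (z = -360 ∨ z = 0 ∨ z = 360) ∧ |a + z - b| ≤ 180 := by
  obtain ⟨h1, h2⟩ := ha
  obtain ⟨h3, h4⟩ := hb
  by_cases h5 : a - b ≤ 180
  · by_cases h6 : -180 ≤ a - b
    · exact ⟨0, by simp, abs_le.2 ⟨by linarith, by linarith⟩⟩
    · exact ⟨360, by simp, abs_le.2 ⟨by linarith, by linarith⟩⟩
  · exact ⟨-360, by simp, abs_le.2 ⟨by linarith, by linarith⟩⟩

theorem le_entry_lift {a b z : ℝ} {d : EReal} (ha : a ∈ Set.Ico (0 : ℝ) 360)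
    (hb : b ∈ Set.Ico (0 : ℝ) 360) (hz : z = -360 ∨ z = 0 ∨ z = 360) :
    d + ((c (angle (a - b)) : ℝ) : EReal) ≤ entry c (a + z) d b := by
  unfold entry
  split_ifs with h
  · rw [abs_lift_eq_angle ha hb hz h, add_comm]
  · exact le_top

theorem exists_entry_lift_eq {a b : ℝ} (d : EReal) (ha : a ∈ Set.Ico (0 : ℝ) 360)
    (hb : b ∈ Set.Ico (0 : ℝ) 360) : ∃ z : ℝ, (z = -360 ∨ z = 0 ∨ z = 360) ∧
      entry c (a + z) d b = d + ((c (angle (a - b)) : ℝ) : EReal) := by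
  obtain ⟨z, hz, h⟩ := exists_lift ha hb
  refine ⟨z, hz, ?_⟩
  rw [entry, if_pos h, abs_lift_eq_angle ha hb hz h, add_comm]

/-! ### The vertex update routine -/

section

attribute [local simp] NExp.eval NExp.cost NExp.var RExp.eval RExp.cost RExp.var BExp.holds BExp.cost
  runs_skip runs_storeN runs_storeR runs_setN runs_setR runs_seq runs_ite block_cons_cons
  block_singleton sW sQ sI sJ sMid sHi sTmp sN sOrd nK nL nPred rInDist rInDir rOutDir
  oBest oS oQ oR oLo oHi oArg oRow oSrc oK xAng xDiff xVal xMin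

open NExp in
/-- Every incoming edge is represented by three rows, with its direction lowered by 360 degrees, its
direction, and its direction raised by 360 degrees. The value of `oK` has to be twice that of `nK`. -/
def liftRows : Cmd :=
  forRange oR (lit 0) (var nK) (block [
    storeR xAng (var oR) (RExp.sub (RExp.get rInDir (var oR)) (RExp.lit 360)),
    storeN oSrc (var oR) (var oR),
    storeR xAng (add (var nK) (var oR)) (RExp.get rInDir (var oR)),
    storeN oSrc (add (var nK) (var oR)) (var oR),
    storeR xAng (add (var oK) (var oR)) (RExp.add (RExp.get rInDir (var oR)) (RExp.lit 360)),
    storeN oSrc (add (var oK) (var oR)) (var oR)])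

open NExp in
/-- The vertex update routine: with rows and columns in the order of their directions, find a best
row of every column, and translate rows to incoming edges and columns to outgoing edges. -/
def updateVertex : Cmd :=
  Cmd.ite (BExp.and (BExp.nlt (lit 0) (var nK)) (BExp.nlt (lit 0) (var nL)))
    (block [
      setN oK (add (var nK) (var nK)),
      liftRows,
      setN oK (add (var oK) (var nK)),
      setN sN (var oK),
      mergeSort xAng,
      forRange oR (lit 0) (var oK) (storeN oRow (var oR) (get sOrd (var oR))),
      setN sN (var nL),
      mergeSort rOutDir,
      bestRows,
      forRange oR (lit 0) (var nL) (storeN nPred (get sOrd (var oR))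
        (get oSrc (get oRow (get oBest (add (var oR) (lit 1))))))])
    skip

/-- The update routine writes only its output and arrays that the main program does not use. -/
theorem natWrites_updateVertex : ∀ a ∈ updateVertex.natWrites, a = nPred ∨ 20 ≤ a := by
  decide

theorem numWrites_updateVertex : ∀ a ∈ updateVertex.numWrites, 20 ≤ a := by
  decide

/-- The rows `0, …, 3 * k - 1`, with angles `ang` and incoming edges `src`, are the lifts by -360, 0
and 360 degrees of the incoming edges with directions `α`. -/
structure Lifted {k : ℕ} (α : Fin k → ℝ) (ang : ℕ → EReal) (src : ℕ → ℕ) : Prop where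
  row : ∀ r < 3 * k, ∃ (i : Fin k) (z : ℝ), (z = -360 ∨ z = 0 ∨ z = 360) ∧
    ang r = ((α i + z : ℝ) : EReal) ∧ src r = i
  lift : ∀ (i : Fin k) (z : ℝ), (z = -360 ∨ z = 0 ∨ z = 360) → ∃ r < 3 * k,
    ang r = ((α i + z : ℝ) : EReal) ∧ src r = i

theorem runs_liftRows {k : ℕ} {α : Fin k → ℝ} {s : State} (hk : s.nat nK 0 = k)
    (hα : ∀ i : Fin k, s.num rInDir i = (α i : EReal)) (hK : s.nat oK 0 = k + k) :
    Runs c liftRows s fun s' t => t ≤ k * 80 + 20 ∧ Lifted α (s'.num xAng) (s'.nat oSrc) := by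
  rw [liftRows]
  refine (runs_forRange (fun x s' => s'.nat nK 0 = k ∧ s'.nat oK 0 = k + k ∧
    s'.num rInDir = s.num rInDir ∧ ∀ i < x,
      (s'.num xAng i = s.num rInDir i - ((360 : ℝ) : EReal) ∧ s'.nat oSrc i = i) ∧
      (s'.num xAng (k + i) = s.num rInDir i ∧ s'.nat oSrc (k + i) = i) ∧
      (s'.num xAng (k + k + i) = s.num rInDir i + ((360 : ℝ) : EReal) ∧ s'.nat oSrc (k + k + i) = i))
    65 0 k ?_ (Nat.zero_le _) ?_ ?_ ?_).mono ?_
  · simp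
  · simp at hk hK
    simp [*]
  · rintro i s - - ⟨h, -⟩ -
    simpa using h
  · rintro x s₁ - hx ⟨h1, h2, h3, h4⟩ h5
    simp at h1 h2 h3 h4 h5
    simp only [block_cons_cons, block_singleton, runs_seq, runs_storeN, runs_storeR]
    simp [h1, h2, h3, h5]
    intro i hi
    rcases hi.lt_or_eq with hlt | rfl
    · obtain ⟨⟨g1, g2⟩, ⟨g3, g4⟩, g5, g6⟩ := h4 i hlt
      refine ⟨⟨?_, ?_⟩, ⟨?_, ?_⟩, ?_, ?_⟩ <;> split_ifs <;>
        first | rfl | assumption | (exfalso; omega)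
    · refine ⟨⟨?_, ?_⟩, ⟨?_, ?_⟩, ?_, ?_⟩ <;> split_ifs <;>
        first | rfl | assumption | (exfalso; omega)
  · rintro s₁ t₁ ⟨⟨h1, h2, h3, h4⟩, -, ht⟩
    refine ⟨by simp at ht; omega, ?_, ?_⟩
    · intro r hr
      by_cases hr1 : r < k
      · obtain ⟨⟨g1, g2⟩, -⟩ := h4 r hr1
        refine ⟨⟨r, hr1⟩, -360, by simp, ?_, g2⟩
        rw [g1, hα ⟨r, hr1⟩, ← EReal.coe_sub, sub_eq_add_neg]
      · by_cases hr2 : r < k + k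
        · obtain ⟨-, ⟨g1, g2⟩, -⟩ := h4 (r - k) (by omega)
          rw [show k + (r - k) = r by omega] at g1 g2
          refine ⟨⟨r - k, by omega⟩, 0, by simp, ?_, g2⟩
          rw [g1, hα ⟨r - k, by omega⟩, add_zero]
        · obtain ⟨-, -, g1, g2⟩ := h4 (r - k - k) (by omega)
          rw [show k + k + (r - k - k) = r by omega] at g1 g2
          refine ⟨⟨r - k - k, by omega⟩, 360, by simp, ?_, g2⟩
          rw [g1, hα ⟨r - k - k, by omega⟩, ← EReal.coe_add]
    · intro i z hz
      obtain ⟨⟨g1, g2⟩, ⟨g3, g4⟩, g5, g6⟩ := h4 i i.2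
      have := i.2
      rcases hz with rfl | rfl | rfl
      · refine ⟨i, by omega, ?_, g2⟩
        rw [g1, hα, ← EReal.coe_sub, sub_eq_add_neg]
      · refine ⟨k + i, by omega, ?_, g4⟩
        rw [g3, hα, add_zero]
      · refine ⟨k + k + i, by omega, ?_, g6⟩
        rw [g5, hα, ← EReal.coe_add]

/-- The incoming edge `i` is an optimal predecessor of the outgoing edge `j`. -/
def IsOptPred (c : ℝ → ℝ) {k l : ℕ} (D : Fin k → EReal) (α : Fin k → ℝ) (β : Fin l → ℝ) (i : ℕ)
    (j : Fin l) : Prop :=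
  ∃ i₀ : Fin k, i = i₀ ∧ ∀ i' : Fin k, D i₀ + ((c (angle (α i₀ - β j)) : ℝ) : EReal) ≤
    D i' + ((c (angle (α i' - β j)) : ℝ) : EReal)

/-- The matrix of lifted incoming edges and outgoing edges, in the orders `row` and `col`. Best rows
increase with the columns, and they are optimal predecessors. -/
theorem exists_matrix (hc : ConvexOn ℝ (Set.Icc 0 180) c) (hm : MonotoneOn c (Set.Icc 0 180))
    {k l : ℕ} {D : Fin k → EReal} {α : Fin k → ℝ} {β : Fin l → ℝ} (hD : ∀ i, D i ≠ ⊥)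
    (hα : ∀ i, α i ∈ Set.Ico (0 : ℝ) 360) (hβ : ∀ j, β j ∈ Set.Ico (0 : ℝ) 360) {s : State}
    (hDs : ∀ i : Fin k, s.num rInDist i = D i) (hβs : ∀ j : Fin l, s.num rOutDir j = (β j : EReal))
    (hlift : Lifted α (s.num xAng) (s.nat oSrc)) (hrow : Enumerates (3 * k) (s.nat oRow))
    (hcol : Enumerates l (s.nat sOrd))
    (hrows : ∀ x y, x ≤ y → y < 3 * k → s.num xAng (s.nat oRow x) ≤ s.num xAng (s.nat oRow y))
    (hcols : ∀ x y, x ≤ y → y < l → s.num rOutDir (s.nat sOrd x) ≤ s.num rOutDir (s.nat sOrd y)) :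
    ∃ M : ℕ → ℕ → EReal, HoldsMatrix c (3 * k) l M s ∧ BestRowsMonotone (3 * k) l M ∧
      ∀ (r q : ℕ) (hq : q < l), IsBestRow (3 * k) M r (q + 1) →
        IsOptPred c D α β (s.nat oSrc (s.nat oRow r)) ⟨s.nat sOrd q, hcol.1 q hq⟩ := by
  -- the angle, the distance and the incoming edge of a row, and the direction of a column
  let A : ℕ → ℝ := fun r => (s.num xAng (s.nat oRow r)).toReal
  let d : ℕ → EReal := fun r => s.num rInDist (s.nat oSrc (s.nat oRow r))
  let B : ℕ → ℝ := fun q => (s.num rOutDir (s.nat sOrd (q - 1))).toReal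
  have hA : ∀ r < 3 * k, ∃ (i : Fin k) (z : ℝ), (z = -360 ∨ z = 0 ∨ z = 360) ∧
      A r = α i + z ∧ d r = D i ∧ s.nat oSrc (s.nat oRow r) = i ∧
      s.num xAng (s.nat oRow r) = (A r : EReal) := by
    intro r hr
    obtain ⟨i, z, hz, h1, h2⟩ := hlift.row _ (hrow.1 r hr)
    refine ⟨i, z, hz, ?_, ?_, h2, ?_⟩
    · simp only [A, h1, EReal.toReal_coe]
    · simp only [d, h2, hDs]
    · simp only [A, h1, EReal.toReal_coe]
  have hB : ∀ q, (h0 : 0 < q) → (hq : q ≤ l) → B q = β ⟨s.nat sOrd (q - 1), hcol.1 _ (by omega)⟩ ∧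
      s.num rOutDir (s.nat sOrd (q - 1)) = (B q : EReal) := by
    intro q h0 hq
    have := hβs ⟨s.nat sOrd (q - 1), hcol.1 _ (by omega)⟩
    simp only at this
    simp only [B, this, EReal.toReal_coe, and_self]
  have hex : ∀ (i : Fin k) (z : ℝ), (z = -360 ∨ z = 0 ∨ z = 360) → ∃ r < 3 * k,
      A r = α i + z ∧ d r = D i := by
    intro i z hz
    obtain ⟨x, hx, h1, h2⟩ := hlift.lift i z hz
    obtain ⟨r, hr, rfl⟩ := hrow.2 x hx
    refine ⟨r, hr, ?_, ?_⟩
    · simp only [A, h1, EReal.toReal_coe]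
    · simp only [d, h2, hDs]
  refine ⟨fun r q => entry c (A r) (d r) (B q), ?_, ?_, ?_⟩
  · intro r hr q h0 hq
    obtain ⟨i, z, -, -, -, -, h⟩ := hA r hr
    refine ⟨A r - B q, ?_, rfl⟩
    rw [h, (hB q h0 hq).2, EReal.coe_sub]
  · refine bestRowsMonotone_entry hc hm ?_ ?_ ?_ ?_
    · intro r r' h h'
      obtain ⟨-, -, -, -, -, -, h1⟩ := hA r (h.trans_lt h')
      obtain ⟨-, -, -, -, -, -, h2⟩ := hA r' h'
      have := hrows r r' h h'
      rw [h1, h2] at this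
      exact_mod_cast this
    · intro q q' h0 h h'
      have := hcols (q - 1) (q' - 1) (by omega) (by omega)
      rw [(hB q h0 (h.trans h')).2, (hB q' (h0.trans_le h) h').2] at this
      exact_mod_cast this
    · intro r hr
      obtain ⟨i, z, -, -, h, -⟩ := hA r hr
      rw [h]; exact hD i
    · rintro ⟨r, hr, hfin⟩ q h0 hq
      obtain ⟨i, z, -, -, h, -⟩ := hA r hr
      rw [h] at hfin
      rw [(hB q h0 hq).1]
      obtain ⟨z', hz', he⟩ := exists_entry_lift_eq (c := c) (D i) (hα i)
        (hβ ⟨s.nat sOrd (q - 1), hcol.1 _ (by omega)⟩)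
      obtain ⟨r', hr', h1, h2⟩ := hex i z' hz'
      refine ⟨r', hr', ?_⟩
      rw [h1, h2, he]
      exact (EReal.add_lt_top hfin (EReal.coe_ne_top _)).ne
  · intro r q hq h
    obtain ⟨i, z, hz, h1, h2, h3, -⟩ := hA r h.1
    refine ⟨i, h3, fun i' => ?_⟩
    have hBq := (hB (q + 1) (Nat.succ_pos _) hq).1
    simp only [Nat.add_sub_cancel] at hBq
    obtain ⟨z', hz', he⟩ := exists_entry_lift_eq (c := c) (D i') (hα i') (hβ ⟨s.nat sOrd q, hcol.1 _ hq⟩)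
    obtain ⟨r', hr', g1, g2⟩ := hex i' z' hz'
    have hle := h.2 r' hr'
    simp only [hBq, h1, h2, g1, g2, he] at hle
    exact (le_entry_lift (hα i) (hβ _) hz).trans hle

theorem runs_updateVertex_main (hc : ConvexOn ℝ (Set.Icc 0 180) c)
    (hm : MonotoneOn c (Set.Icc 0 180)) {k l : ℕ} {D : Fin k → EReal} {α : Fin k → ℝ}
    {β : Fin l → ℝ} {s : State} (hD : ∀ i, D i ≠ ⊥) (hα : ∀ i, α i ∈ Set.Ico (0 : ℝ) 360)
    (hβ : ∀ j, β j ∈ Set.Ico (0 : ℝ) 360) (hs : HoldsVertex s D α β) (hk : 0 < k) (hl : 0 < l) :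
    Runs c updateVertex s fun s' t =>
      t ≤ (k + l) * (Nat.clog 2 (3 * k) + Nat.clog 2 l + Nat.log 2 l + 1) * 4000 ∧
        ∀ j : Fin l, IsOptPred c D α β (s'.nat nPred j) j := by
  obtain ⟨hK, hL, hin, hout⟩ := hs
  rw [updateVertex, runs_ite]
  refine ⟨fun _ => ?_, fun h => absurd (by simp at hK hL; simp [hK, hL, hk, hl]) h⟩
  simp only [block_cons_cons, block_singleton, runs_seq, runs_setN]
  refine ((runs_liftRows (k := k) (α := α) (by simpa using hK)
    (fun i => by simpa using (hin i).2) (by simp at hK; simp [hK])).frame).mono ?_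
  rintro s₁ t₁ ⟨⟨ht₁, hlift⟩, fn, fr⟩
  have a1 : s₁.nat 0 0 = k := by rw [fn 0 (by decide)]; simpa using hK
  have a2 : s₁.nat 1 0 = l := by rw [fn 1 (by decide)]; simpa using hL
  have a3 : s₁.nat 39 0 = k + k := by rw [fn 39 (by decide)]; simp at hK; simp [hK]
  have a4 : s₁.num 0 = s.num 0 := by rw [fr 0 (by decide)]; simp
  have a5 : s₁.num 2 = s.num 2 := by rw [fr 2 (by decide)]; simp
  clear fn fr
  refine ((runs_mergeSort (n := 3 * k) ?_).frame).mono ?_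
  · simp [a1, a3]; omega
  rintro s₂ t₂ ⟨⟨ht₂, hord, hsorted⟩, fn, fr⟩
  have b1 : s₂.nat 39 0 = 3 * k := by rw [fn 39 (by decide)]; simp [a1, a3]; omega
  have b2 : s₂.nat 1 0 = l := by rw [fn 1 (by decide)]; simpa using a2
  have b3 : s₂.nat 38 = s₁.nat 38 := by rw [fn 38 (by decide)]; simp
  have b4 : s₂.num = s₁.num := by
    funext a; rw [fr a (by exact List.not_mem_nil)]; simp
  clear fn fr
  refine ((runs_forRange (fun x s' => s'.nat oK 0 = 3 * k ∧ s'.nat sOrd = s₂.nat sOrd ∧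
    ∀ r < x, s'.nat oRow r = s₂.nat sOrd r) 10 0 (3 * k) (by simp) (Nat.zero_le _)
    ?_ ?_ ?_).frame).mono ?_
  · simp [b1]
  · rintro i s - - ⟨h, -⟩ -
    simpa using h
  · rintro i s₃ - hi ⟨h1, h2, h3⟩ h4
    simp at h1 h2 h3 h4
    simp [*]
    intro r hr
    split_ifs with h
    · rw [h]
    · exact h3 r (by omega)
  rintro s₃ t₃ ⟨⟨⟨-, -, hrow⟩, -, ht₃⟩, fn, fr⟩
  have d2 : s₃.nat 1 0 = l := by rw [fn 1 (by decide)]; simpa using b2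
  have d3 : s₃.nat 38 = s₁.nat 38 := by rw [fn 38 (by decide)]; exact b3
  have d4 : s₃.num = s₁.num := by
    funext a; rw [fr a (by exact List.not_mem_nil), b4]
  have d5 : s₃.nat 39 0 = 3 * k := by rw [fn 39 (by decide)]; exact b1
  clear fn fr
  refine ((runs_mergeSort (n := l) ?_).frame).mono ?_
  · simp [d2]
  rintro s₄ t₄ ⟨⟨ht₄, hcol, hcols⟩, fn, fr⟩
  have e2 : s₄.nat 1 0 = l := by rw [fn 1 (by decide)]; simpa using d2
  have e3 : s₄.nat 38 = s₁.nat 38 := by rw [fn 38 (by decide)]; simpa using d3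
  have e4 : s₄.num = s₁.num := by
    funext a; rw [fr a (by exact List.not_mem_nil)]; simpa using congrFun d4 a
  have e5 : s₄.nat 39 0 = 3 * k := by rw [fn 39 (by decide)]; simpa using d5
  have e6 : ∀ r < 3 * k, s₄.nat 37 r = s₂.nat 28 r := by
    intro r hr; rw [fn 37 (by decide)]; simpa using hrow r hr
  clear fn fr
  obtain ⟨M, hMat, hMono, hOpt⟩ := exists_matrix hc hm hD hα hβ (s := s₄)
    (fun i => by rw [e4, a4]; exact (hin i).1) (fun j => by rw [e4, a5]; exact hout j)
    (by simp at hlift; simpa [e3, e4] using hlift)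
    ⟨fun x hx => by simp at hord; simp [e6 x hx]; exact hord.1 x hx, fun x hx => by
      obtain ⟨y, hy, rfl⟩ := hord.2 x hx
      exact ⟨y, hy, e6 y hy⟩⟩ hcol
    (fun x y hxy hy => by
      have := hsorted x y hxy hy
      simp at this
      simp [e4, e6 x (hxy.trans_lt hy), e6 y hy]
      exact this)
    (fun x y hxy hy => by
      have := hcols x y hxy hy
      simp [d4] at this
      simp [e4]
      exact this)
  refine ((runs_bestRows hMat hMono e2 e5 (by omega) hl).frame).mono ?_
  rintro s₅ t₅ ⟨⟨ht₅, hbest⟩, fn, fr⟩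
  have f1 : s₅.nat 1 0 = l := by rw [fn 1 (by decide)]; exact e2
  have f28 : s₅.nat 28 = s₄.nat 28 := fn 28 (by decide)
  have f37 : s₅.nat 37 = s₄.nat 37 := fn 37 (by decide)
  have f38 : s₅.nat 38 = s₄.nat 38 := fn 38 (by decide)
  clear fn fr
  -- the property of `nPred` is stable under writing a cell again, so that it does not matter that the
  -- sorted order has no repetitions
  refine (runs_forRange (fun x s' => s'.nat nL 0 = l ∧ s'.nat sOrd = s₄.nat sOrd ∧
    s'.nat oRow = s₄.nat oRow ∧ s'.nat oSrc = s₄.nat oSrc ∧ s'.nat oBest = s₅.nat oBest ∧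
    ∀ q < x, ∀ h : s₄.nat sOrd q < l,
      IsOptPred c D α β (s'.nat nPred (s₄.nat sOrd q)) ⟨s₄.nat sOrd q, h⟩) 20 0 l (by simp)
    (Nat.zero_le _) ?_ ?_ ?_).mono ?_
  · simp [f1, f28, f37, f38]
  · rintro i s - - ⟨h, -⟩ -
    simpa using h
  · rintro q s₆ - hq ⟨h1, h2, h3, h4, h5, h6⟩ h7
    have hnew := hOpt _ q hq (hbest (q + 1) (Nat.succ_pos _) hq)
    simp [e3] at hnew
    simp at h1 h2 h3 h4 h5 h6 h7
    simp [*]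
    intro q' hq' hlt
    split_ifs with heq
    · simp only [heq]; exact hnew
    · rcases hq'.lt_or_eq with hq' | rfl
      · exact h6 q' hq' hlt
      · exact absurd rfl heq
  · rintro s₆ t₆ ⟨⟨-, -, -, -, -, h⟩, -, ht₆⟩
    constructor
    · have p1 : (3 * k * 150 + 60) * (Nat.clog 2 (3 * k) + 1)
          ≤ (k + l) * 510 * (Nat.clog 2 (3 * k) + 1) := Nat.mul_le_mul_right _ (by omega)
      have p2 : (l * 150 + 60) * (Nat.clog 2 l + 1) ≤ (k + l) * 510 * (Nat.clog 2 l + 1) :=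
        Nat.mul_le_mul_right _ (by omega)
      have p3 : ((3 * k + 3 * l) * 300 + 100) * (Nat.log 2 l + 2)
          ≤ (k + l) * 1000 * (Nat.log 2 l + 2) := Nat.mul_le_mul_right _ (by omega)
      have p4 : (k + l) * 510 * (Nat.clog 2 (3 * k) + 1)
        = (k + l) * Nat.clog 2 (3 * k) * 510 + (k + l) * 510 := by ring
      have p5 : (k + l) * 510 * (Nat.clog 2 l + 1)
        = (k + l) * Nat.clog 2 l * 510 + (k + l) * 510 := by ring
      have p6 : (k + l) * 1000 * (Nat.log 2 l + 2)
        = (k + l) * Nat.log 2 l * 1000 + (k + l) * 2000 := by ring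
      have p7 : (k + l) * (Nat.clog 2 (3 * k) + Nat.clog 2 l + Nat.log 2 l + 1) * 4000
        = (k + l) * Nat.clog 2 (3 * k) * 4000 + (k + l) * Nat.clog 2 l * 4000
          + (k + l) * Nat.log 2 l * 4000 + (k + l) * 4000 := by ring
      rw [p7]
      rw [p4] at p1; rw [p5] at p2; rw [p6] at p3
      simp only [NExp.cost, NExp.var, BExp.cost] at ht₁ ht₃ ht₆ ⊢
      omega
    · intro j
      obtain ⟨q, hq, hj⟩ := hcol.2 j j.2
      have := h q hq (by rw [hj]; exact j.2)
      simp only [hj] at this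
      exact this

end

/-- A bound on the number of operations of a vertex update with `k` incoming and `l` outgoing edges.
Nothing is done if one of the numbers is zero. -/
def updateTime (k l : ℕ) : ℕ :=
  if 0 < k ∧ 0 < l then (k + l) * (Nat.clog 2 (3 * k) + Nat.clog 2 l + Nat.log 2 l + 1) * 4000
  else 20

theorem runs_updateVertex (hc : ConvexOn ℝ (Set.Icc 0 180) c)
    (hm : MonotoneOn c (Set.Icc 0 180)) {k l : ℕ} {D : Fin k → EReal} {α : Fin k → ℝ}
    {β : Fin l → ℝ} {s : State} (hD : ∀ i, D i ≠ ⊥) (hα : ∀ i, α i ∈ Set.Ico (0 : ℝ) 360)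
    (hβ : ∀ j, β j ∈ Set.Ico (0 : ℝ) 360) (hs : HoldsVertex s D α β) :
    Runs c updateVertex s fun s' t => t ≤ updateTime k l ∧
      (0 < k → ∀ j : Fin l, IsOptPred c D α β (s'.nat nPred j) j) := by
  by_cases h : 0 < k ∧ 0 < l
  · refine (runs_updateVertex_main hc hm hD hα hβ hs h.1 h.2).mono ?_
    rintro s' t ⟨h1, h2⟩
    rw [updateTime, if_pos h]
    exact ⟨h1, fun _ => h2⟩
  · rw [updateTime, if_neg h, updateVertex, runs_ite]
    obtain ⟨h1, h2, -, -⟩ := hs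
    simp only [BExp.holds, NExp.eval, NExp.var, h1, h2, BExp.cost, NExp.cost, runs_skip]
    exact ⟨fun h' => absurd h' h, fun _ => ⟨by omega, fun hk j => absurd ⟨hk, j.pos⟩ h⟩⟩

theorem natLog_le {n : ℕ} {x : ℝ} (hx : 0 ≤ x) (h : (n : ℝ) ≤ Real.exp x) :
    (Nat.log 2 n : ℝ) ≤ 2 * x := by
  rcases Nat.eq_zero_or_pos n with rfl | hn
  · simpa using hx
  have h1 : (2 : ℝ) ^ Nat.log 2 n ≤ n := by exact_mod_cast Nat.pow_log_le_self 2 hn.ne'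
  have h2 := Real.log_le_log (by positivity) (h1.trans h)
  rw [Real.log_exp, Real.log_pow] at h2
  have h3 := Real.log_two_gt_d9
  nlinarith [Nat.cast_nonneg (α := ℝ) (Nat.log 2 n)]

theorem natClog_le {n : ℕ} {x : ℝ} (hx : 0 ≤ x) (h : (n : ℝ) ≤ Real.exp x) :
    (Nat.clog 2 n : ℝ) ≤ 2 * x + 1 := by
  have h1 : Nat.clog 2 n ≤ Nat.log 2 n + 1 := by
    rw [Nat.clog_le_iff_le_pow (by norm_num)]
    exact (Nat.lt_pow_succ_log_self (by norm_num) n).le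
  have h2 : (Nat.clog 2 n : ℝ) ≤ Nat.log 2 n + 1 := by exact_mod_cast h1
  linarith [natLog_le hx h]

theorem half_le_log (k l : ℕ) : 1 / 2 ≤ Real.log (2 + (k : ℝ) * l) := by
  have h : Real.log 2 ≤ Real.log (2 + (k : ℝ) * l) :=
    Real.log_le_log (by norm_num) (by nlinarith [Nat.cast_nonneg (α := ℝ) (k * l)])
  linarith [Real.log_two_gt_d9]

/-- The logarithms to base two of `3 * k` and `l` are at most a multiple of `log (2 + k * l)`, since
`3 * k ≤ (2 + k * l) ^ 2`. -/
theorem updateTime_le {k l : ℕ} (h : 1 ≤ k + l) :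
    (updateTime k l : ℝ) ≤ 80000 * (((k : ℝ) + l) * Real.log (2 + (k : ℝ) * l)) := by
  set L := Real.log (2 + (k : ℝ) * l)
  have hL : 1 / 2 ≤ L := half_le_log k l
  have hkl : (1 : ℝ) ≤ (k : ℝ) + l := by exact_mod_cast h
  unfold updateTime
  split_ifs with h0
  · have hk : (1 : ℝ) ≤ k := by exact_mod_cast h0.1
    have hl : (1 : ℝ) ≤ l := by exact_mod_cast h0.2
    have hexp : Real.exp L = 2 + (k : ℝ) * l := Real.exp_log (by positivity)
    have h1 : (Nat.clog 2 (3 * k) : ℝ) ≤ 2 * (2 * L) + 1 := by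
      refine natClog_le (by linarith) ?_
      rw [two_mul, Real.exp_add, hexp]
      push_cast
      nlinarith [mul_le_mul hk hl (by norm_num) (by linarith)]
    have h2 : (l : ℝ) ≤ Real.exp L := by rw [hexp]; nlinarith
    have h3 := natClog_le (by linarith) h2
    have h4 := natLog_le (by linarith) h2
    have h5 : (Nat.clog 2 (3 * k) : ℝ) + Nat.clog 2 l + Nat.log 2 l + 1 ≤ 20 * L := by linarith
    push_cast
    have := mul_le_mul_of_nonneg_left h5 (show (0 : ℝ) ≤ (k : ℝ) + l by linarith)
    nlinarith
  · push_cast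
    nlinarith

/-! ### Least costs of walks -/

namespace Graph

variable {G : Graph} {p : ℕ} {e e' : Fin G.m}

theorem walkCost_concat (w : List (Fin G.m)) (e' e : Fin G.m) :
    G.walkCost c (w ++ [e'] ++ [e])
      = G.walkCost c (w ++ [e']) + (c (angle (G.dir e' - G.dir e)) + G.edgeCost e) := by
  induction w with
  | nil => simp [walkCost]; ring
  | cons a w ih =>
    cases w with
    | nil => simp [walkCost]; ring
    | cons b w =>
      simp only [List.cons_append, walkCost] at ih ⊢
      rw [ih]; ring

theorem isWalkTo_singleton {a : Fin G.m} : G.IsWalkTo e [a] ↔ a = e ∧ G.tail e = G.source := by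
  simp only [IsWalkTo, List.isChain_singleton, List.head?_cons, List.getLast?_singleton,
    Option.some.injEq, true_and]
  constructor
  · rintro ⟨⟨b, rfl, h⟩, rfl⟩; exact ⟨rfl, h⟩
  · rintro ⟨rfl, h⟩; exact ⟨⟨_, rfl, h⟩, rfl⟩

theorem isWalkTo_concat (w : List (Fin G.m)) (e' a : Fin G.m) :
    G.IsWalkTo e (w ++ [e'] ++ [a]) ↔
      a = e ∧ G.head e' = G.tail e ∧ G.IsWalkTo e' (w ++ [e']) := by
  have hh : (w ++ [e'] ++ [a]).head? = (w ++ [e']).head? := by cases w <;> simp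
  simp only [IsWalkTo, hh, List.getLast?_append, List.getLast?_singleton, Option.some_or,
    Option.some.injEq]
  rw [List.isChain_append]
  simp only [List.isChain_singleton, List.getLast?_append, List.getLast?_singleton, Option.some_or,
    Option.mem_def, Option.some.injEq, List.head?_cons, forall_eq', true_and]
  constructor
  · rintro ⟨⟨h1, h2⟩, h3, rfl⟩; exact ⟨rfl, h2, h1, h3, trivial⟩
  · rintro ⟨rfl, h2, h1, h3, -⟩; exact ⟨⟨h1, h2⟩, h3, rfl⟩

theorem minCost_le {w : List (Fin G.m)} (hw : G.IsWalkTo e w) (hp : w.length ≤ p) :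
    G.minCost c p e ≤ ((G.walkCost c w : ℝ) : EReal) :=
  iInf₂_le w ⟨hw, hp⟩

theorem le_minCost {x : EReal} (h : ∀ w, G.IsWalkTo e w → w.length ≤ p →
    x ≤ ((G.walkCost c w : ℝ) : EReal)) : x ≤ G.minCost c p e :=
  le_iInf₂ fun w hw => h w hw.1 hw.2

/-- Every walk consists of its last edge, or of a shorter walk and its last edge. -/
theorem IsWalkTo.cases {w : List (Fin G.m)} (hw : G.IsWalkTo e w) :
    (w = [e] ∧ G.tail e = G.source) ∨
      ∃ u e', w = u ++ [e'] ++ [e] ∧ G.head e' = G.tail e ∧ G.IsWalkTo e' (u ++ [e']) := by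
  rcases List.eq_nil_or_concat w with rfl | ⟨u, a, rfl⟩
  · simp [IsWalkTo] at hw
  rcases List.eq_nil_or_concat u with rfl | ⟨u, b, rfl⟩
  · obtain ⟨rfl, h⟩ := isWalkTo_singleton.1 (by simpa using hw)
    exact Or.inl ⟨by simp, h⟩
  · simp only [List.concat_eq_append] at hw ⊢
    obtain ⟨rfl, h1, h2⟩ := (isWalkTo_concat u b a).1 hw
    exact Or.inr ⟨u, b, rfl, h1, h2⟩

theorem minCost_one_of_tail_eq (h : G.tail e = G.source) :
    G.minCost c 1 e = (G.edgeCost e : EReal) := by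
  refine le_antisymm (minCost_le (isWalkTo_singleton.2 ⟨rfl, h⟩) le_rfl) (le_minCost ?_)
  intro w hw hl
  rcases hw.cases with ⟨rfl, -⟩ | ⟨u, e', rfl, -⟩
  · exact le_rfl
  · simp at hl

theorem minCost_one_of_tail_ne (h : G.tail e ≠ G.source) : G.minCost c 1 e = ⊤ := by
  refine top_le_iff.1 (le_minCost ?_)
  intro w hw hl
  rcases hw.cases with ⟨rfl, h'⟩ | ⟨u, e', rfl, -⟩
  · exact absurd h' h
  · simp at hl

theorem minCost_succ_le : G.minCost c (p + 1) e ≤ G.minCost c p e :=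
  le_minCost fun _ hw hl => minCost_le hw (by omega)

theorem minCost_succ_le_add (h : G.head e' = G.tail e) : G.minCost c (p + 1) e ≤
    G.minCost c p e' + ((c (angle (G.dir e' - G.dir e)) + G.edgeCost e : ℝ) : EReal) := by
  rw [← EReal.sub_le_iff_le_add (Or.inl (EReal.coe_ne_bot _)) (Or.inl (EReal.coe_ne_top _))]
  refine le_minCost fun w hw hl => ?_
  rw [EReal.sub_le_iff_le_add (Or.inl (EReal.coe_ne_bot _)) (Or.inl (EReal.coe_ne_top _))]
  rcases List.eq_nil_or_concat w with rfl | ⟨u, a, rfl⟩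
  · simp [IsWalkTo] at hw
  simp only [List.concat_eq_append] at hw hl ⊢
  obtain rfl : a = e' := by simpa [IsWalkTo] using hw.2.2
  have := minCost_le (c := c) (p := p + 1) ((isWalkTo_concat u a e).2 ⟨rfl, h, hw⟩)
    (by simp at hl ⊢; omega)
  rw [walkCost_concat] at this
  exact_mod_cast this

/-- A lower bound for the walks with at most `p` edges and for their extensions by `e` is a lower bound
for the walks with at most `p + 1` edges. -/
theorem le_minCost_succ {x : EReal} (hp : 1 ≤ p) (h : x ≤ G.minCost c p e)
    (h' : ∀ e', G.head e' = G.tail e → x ≤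
      G.minCost c p e' + ((c (angle (G.dir e' - G.dir e)) + G.edgeCost e : ℝ) : EReal)) :
    x ≤ G.minCost c (p + 1) e := by
  refine le_minCost fun w hw hl => ?_
  rcases hw.cases with ⟨rfl, -⟩ | ⟨u, e', rfl, he, hu⟩
  · exact h.trans (minCost_le hw hp)
  · rw [walkCost_concat, EReal.coe_add]
    refine (h' e' he).trans (add_le_add_left (minCost_le hu ?_) _)
    simp at hl ⊢; omega

/-- Least costs are not `-∞`, since walks with at most `p` edges have bounded cost. -/
theorem minCost_ne_bot (h0 : ∀ x ∈ Set.Icc (0 : ℝ) 180, 0 ≤ c x) (hp : 1 ≤ p) :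
    G.minCost c p e ≠ ⊥ := by
  let B : ℝ := ∑ a, |G.edgeCost a|
  have hB : ∀ a, -B ≤ G.edgeCost a := by
    intro a
    have : |G.edgeCost a| ≤ B :=
      Finset.single_le_sum (f := fun a => |G.edgeCost a|) (fun i _ => abs_nonneg _)
        (Finset.mem_univ a)
    linarith [neg_abs_le (G.edgeCost a)]
  have hB0 : 0 ≤ B := Finset.sum_nonneg fun i _ => abs_nonneg _
  suffices H : ∀ a, ((-(p * B) : ℝ) : EReal) ≤ G.minCost c p a by
    intro hbot
    have := H e
    rw [hbot, le_bot_iff] at this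
    exact EReal.coe_ne_bot _ this
  induction p, hp using Nat.le_induction with
  | base =>
    intro a
    by_cases h : G.tail a = G.source
    · rw [minCost_one_of_tail_eq h]
      have := hB a
      exact_mod_cast (by simpa using this : -((1 : ℝ) * B) ≤ G.edgeCost a)
    · rw [minCost_one_of_tail_ne h]; exact le_top
  | succ p hp ih =>
    intro a
    refine le_minCost_succ hp (le_trans ?_ (ih a)) fun e' he' => ?_
    · rw [EReal.coe_le_coe_iff]; push_cast; nlinarith
    · refine le_trans ?_ (add_le_add_left (ih e') _)
      rw [← EReal.coe_add, EReal.coe_le_coe_iff]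
      push_cast
      linarith [hB a, h0 _ (angle_mem (G.dir_mem e') (G.dir_mem a))]

end Graph

/-! ### Reading the graph -/

section

attribute [local simp] NExp.eval NExp.cost NExp.var RExp.eval RExp.cost RExp.var BExp.holds BExp.cost
  runs_skip runs_storeN runs_storeR runs_setN runs_setR runs_seq runs_ite block_cons_cons
  block_singleton nK nL nPred nVertices nEdges nP nSource nInOff nInEdge nOutOff nOutEdge nParent nT
  nV nJ nE nI rInDist rInDir rOutDir rDir rEdgeCost rDist rNewDist rX rY adj degree

variable {G : Graph} {p : ℕ}

theorem HoldsGraph.congr {s s' : State} (h : HoldsGraph s G p)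
    (hn : ∀ a, 3 ≤ a → a ≤ 10 → s'.nat a = s.nat a) (hr : ∀ a, 3 ≤ a → a ≤ 4 → s'.num a = s.num a) :
    HoldsGraph s' G p := by
  unfold HoldsGraph at *
  rw [hn _ (by simp) (by simp), hn _ (by simp) (by simp), hn _ (by simp) (by simp),
    hn _ (by simp) (by simp), hn nInOff (by simp) (by simp), hn nInEdge (by simp) (by simp),
    hn nOutOff (by simp) (by simp), hn nOutEdge (by simp) (by simp), hr _ (by simp) (by simp),
    hr _ (by simp) (by simp)]
  exact h

theorem HoldsGraph.exists_inEdges {s : State} (h : HoldsGraph s G p) (v : Fin G.n) :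
    ∃ f : Fin (G.inDeg v) → Fin G.m,
      (∀ i, G.head (f i) = v ∧ s.nat nInEdge (s.nat nInOff v + i) = f i) ∧
        ∀ e, G.head e = v → ∃ i, f i = e := by
  obtain ⟨-, -, -, -, -, h, -⟩ := h
  obtain ⟨-, h1, h2⟩ := h v
  choose f hf using fun i : Fin (G.inDeg v) => h1 i i.2
  refine ⟨f, hf, fun e he => ?_⟩
  obtain ⟨j, hj, h3⟩ := h2 e he
  exact ⟨⟨j, hj⟩, Fin.ext ((hf ⟨j, hj⟩).2.symm.trans h3)⟩

theorem HoldsGraph.exists_outEdges {s : State} (h : HoldsGraph s G p) (v : Fin G.n) :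
    ∃ g : Fin (G.outDeg v) → Fin G.m,
      (∀ j, G.tail (g j) = v ∧ s.nat nOutEdge (s.nat nOutOff v + j) = g j) ∧
        ∀ e, G.tail e = v → ∃ j, g j = e := by
  obtain ⟨-, -, -, -, -, -, h⟩ := h
  obtain ⟨-, h1, h2⟩ := h v
  choose g hg using fun i : Fin (G.outDeg v) => h1 i i.2
  refine ⟨g, hg, fun e he => ?_⟩
  obtain ⟨j, hj, h3⟩ := h2 e he
  exact ⟨⟨j, hj⟩, Fin.ext ((hg ⟨j, hj⟩).2.symm.trans h3)⟩

/-! ### Initialization -/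

theorem runs_initDist {s : State} (h : HoldsGraph s G p) :
    Runs c initDist s fun s' t => t ≤ G.m * 30 + G.outDeg G.source * 40 + 100 ∧
      HoldsGraph s' G p ∧ ∀ e : Fin G.m, s'.num rDist e = G.minCost c 1 e ∧
        s'.nat nParent e = G.m := by
  suffices H : Runs c initDist s fun s' t => t ≤ G.m * 30 + G.outDeg G.source * 40 + 100 ∧
      ∀ e : Fin G.m, s'.num rDist e = G.minCost c 1 e ∧ s'.nat nParent e = G.m by
    refine H.frame.mono ?_
    rintro s' t ⟨⟨h1, h2⟩, hn, hr⟩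
    refine ⟨h1, h.congr (fun a h3 h4 => hn a ?_) (fun a h3 h4 => hr a ?_), h2⟩
    · revert a; decide
    · revert a; decide
  have hm := h.2.1
  have hs := h.2.2.2.1
  have hcost : ∀ e : Fin G.m, s.num rEdgeCost e = (G.edgeCost e : EReal) :=
    fun e => (h.2.2.2.2.1 e).2
  have hdeg := (h.2.2.2.2.2.2 G.source).1
  obtain ⟨g, hg, hg'⟩ := h.exists_outEdges G.source
  rw [initDist]
  simp only [block_cons_cons, block_singleton, runs_seq, runs_setN]
  refine ((runs_forRange (fun x s' => s'.nat nEdges 0 = G.m ∧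
    ∀ e < x, s'.num rDist e = ⊤ ∧ s'.nat nParent e = G.m) 15 0 G.m (by simp) (Nat.zero_le _)
    ?_ ?_ ?_).frame).mono ?_
  · simpa using hm
  · rintro i s - - ⟨h, -⟩ -
    simpa using h
  · rintro x s₁ - hx ⟨h1, h2⟩ h3
    simp at h1 h2 h3
    simp [h1, h3]
    intro e he
    rcases he.lt_or_eq with he | rfl
    · exact ⟨fun _ => (h2 e he).1, fun _ => (h2 e he).2⟩
    · simp
  rintro s₁ t₁ ⟨⟨⟨h1, h2⟩, -, ht₁⟩, fn, fr⟩
  have a6 : s₁.nat 6 0 = G.source := by rw [fn 6 (by decide)]; exact hs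
  have a9 : s₁.nat 9 = s.nat 9 := fn 9 (by decide)
  have a10 : s₁.nat 10 = s.nat 10 := fn 10 (by decide)
  have b4 : s₁.num 4 = s.num 4 := fr 4 (by decide)
  clear fn fr
  refine (runs_forRange (fun x s' => s'.nat nV 0 = G.source ∧ s'.nat nOutOff = s.nat nOutOff ∧
    s'.nat nOutEdge = s.nat nOutEdge ∧ s'.num rEdgeCost = s.num rEdgeCost ∧
    ∀ e : Fin G.m, s'.nat nParent e = G.m ∧
      (s'.num rDist e = G.edgeCost e ∧ G.tail e = G.source ∨
        s'.num rDist e = ⊤ ∧ ∀ j : Fin (G.outDeg G.source), j < x → g j ≠ e)) 20 0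
    (G.outDeg G.source) (by simp) (Nat.zero_le _) ?_ ?_ ?_).mono ?_
  · simp [a6, a9, a10, b4]
    intro e
    exact ⟨(h2 e e.2).2, Or.inr (h2 e e.2).1⟩
  · rintro i s' - - ⟨k1, k2, -⟩ -
    simp at k1 k2 hdeg
    simp [k1, k2, hdeg]
  · rintro j s₂ - hj ⟨k1, k2, k3, k4, k5⟩ k6
    obtain ⟨q1, q2⟩ := hg ⟨j, hj⟩
    simp at k1 k2 k3 k4 k5 k6 q2 hcost
    simp [k1, k2, k3, k4, k6, q2, hcost]
    intro e
    refine ⟨(k5 e).1, ?_⟩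
    by_cases he : e = g ⟨j, hj⟩
    · subst he
      simp [q1]
    · have he' : ((e : ℕ) ≠ g ⟨j, hj⟩) := fun h => he (Fin.ext h)
      simp only [he', if_false]
      rcases (k5 e).2 with h7 | ⟨h7, h8⟩
      · exact Or.inl h7
      · refine Or.inr ⟨h7, fun i hi hgi => ?_⟩
        rcases Nat.lt_or_ge i j with h9 | h9
        · exact h8 i h9 hgi
        · have : i = ⟨j, hj⟩ := Fin.ext (by simp; omega)
          subst this
          exact he hgi.symm
  · rintro s₂ t₂ ⟨⟨k1, k2, k3, k4, k5⟩, -, ht₂⟩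
    refine ⟨?_, fun e => ⟨?_, (k5 e).1⟩⟩
    · simp at ht₁ ht₂ ⊢; omega
    · rcases (k5 e).2 with ⟨h7, h8⟩ | ⟨h7, h8⟩
      · rw [h7, Graph.minCost_one_of_tail_eq h8]
      · rw [h7, Graph.minCost_one_of_tail_ne]
        intro h9
        obtain ⟨j, hj⟩ := hg' e h9
        exact h8 j j.2 hj

/-! ### The update of one vertex -/

theorem runs_loadVertex {s : State} (h : HoldsGraph s G p) (v : Fin G.n) (hv : s.nat nV 0 = v)
    {d : Fin G.m → EReal} (hd : ∀ e : Fin G.m, s.num rDist e = d e)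
    {f : Fin (G.inDeg v) → Fin G.m} (hf : ∀ i : Fin (G.inDeg v), s.nat nInEdge (s.nat nInOff v + i) = f i)
    {g : Fin (G.outDeg v) → Fin G.m} 
    (hg : ∀ j : Fin (G.outDeg v), s.nat nOutEdge (s.nat nOutOff v + j) = g j) :
    Runs c loadVertex s fun s' t => t ≤ (G.inDeg v + G.outDeg v) * 60 + 60 ∧
      HoldsVertex s' (fun i => d (f i)) (fun i => G.dir (f i)) (fun j => G.dir (g j)) := by
  have hdir : ∀ e : Fin G.m, s.num rDir e = (G.dir e : EReal) := fun e => (h.2.2.2.2.1 e).1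
  have hin := (h.2.2.2.2.2.1 v).1
  have hout := (h.2.2.2.2.2.2 v).1
  rw [loadVertex]
  simp only [block_cons_cons, block_singleton, runs_seq, runs_setN]
  refine ((runs_forRange (fun x s' => s'.nat nK 0 = G.inDeg v ∧ s'.nat nV 0 = v ∧
    s'.nat nInOff = s.nat nInOff ∧ s'.nat nInEdge = s.nat nInEdge ∧ s'.num rDist = s.num rDist ∧
    s'.num rDir = s.num rDir ∧ ∀ i : Fin (G.inDeg v), i < x →
      s'.num rInDist i = d (f i) ∧ s'.num rInDir i = G.dir (f i)) 30 0 (G.inDeg v) (by simp)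
    (Nat.zero_le _) ?_ ?_ ?_).frame).mono ?_
  · simp at hin hv
    simp [hin, hv]
  · rintro i s - - ⟨h, -⟩ -
    simpa using h
  · rintro x s₁ - hx ⟨h1, h2, h3, h4, h5, h6, h7⟩ h8
    have q := hf ⟨x, hx⟩
    simp at h1 h2 h3 h4 h5 h6 h7 h8 q hd hdir
    simp [h1, h2, h3, h4, h5, h6, h8, q, hd, hdir]
    intro i hi
    split_ifs with he
    · have : i = ⟨x, hx⟩ := Fin.ext he
      simp [this]
    · exact h7 i (by omega)
  rintro s₁ t₁ ⟨⟨⟨h1, h2, h3, h4, h5, h6, h7⟩, -, ht₁⟩, fn, fr⟩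
  have a1 : s₁.nat 1 0 = G.outDeg v := by
    rw [fn 1 (by decide)]; simp at hout hv; simp [hout, hv]
  have a9 : s₁.nat 9 = s.nat 9 := by rw [fn 9 (by decide)]; simp
  have a10 : s₁.nat 10 = s.nat 10 := by rw [fn 10 (by decide)]; simp
  clear fn fr
  refine ((runs_forRange (fun x s' => s'.nat nL 0 = G.outDeg v ∧ s'.nat nV 0 = v ∧
    s'.nat nOutOff = s.nat nOutOff ∧ s'.nat nOutEdge = s.nat nOutEdge ∧
    s'.num rDir = s.num rDir ∧ ∀ j : Fin (G.outDeg v), j < x →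
      s'.num rOutDir j = G.dir (g j)) 30 0 (G.outDeg v) (by simp)
    (Nat.zero_le _) ?_ ?_ ?_).frame).mono ?_
  · simp at h2 h6
    simp [a1, a9, a10, h2, h6]
  · rintro i s - - ⟨h, -⟩ -
    simpa using h
  · rintro x s₂ - hx ⟨k1, k2, k3, k4, k5, k6⟩ k7
    have q := hg ⟨x, hx⟩
    simp at k1 k2 k3 k4 k5 k6 k7 q hdir
    simp [k1, k2, k3, k4, k5, k7, q, hdir]
    intro j hj
    split_ifs with he
    · have : j = ⟨x, hx⟩ := Fin.ext he
      simp [this]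
    · exact k6 j (by omega)
  rintro s₂ t₂ ⟨⟨⟨k1, k2, k3, k4, k5, k6⟩, -, ht₂⟩, fn, fr⟩
  refine ⟨?_, ?_, k1, fun i => ?_, fun j => k6 j j.2⟩
  · simp at ht₁ ht₂ ⊢; omega
  · rw [fn nK (by decide)]; exact h1
  · rw [fr rInDist (by decide), fr rInDir (by decide)]
    exact h7 i i.2

theorem runs_angleCostOf {a b : ℝ} (ha : a ∈ Set.Ico (0 : ℝ) 360) (hb : b ∈ Set.Ico (0 : ℝ) 360)
    {s : State} (hx : s.num rX 0 = ((a - b : ℝ) : EReal)) :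
    Runs c (angleCostOf rX rY) s fun s' t => t ≤ 40 ∧ s'.nat = s.nat ∧
      s'.num rY 0 = ((c (angle (a - b)) : ℝ) : EReal) ∧
        ∀ z, z ≠ rX → z ≠ rY → s'.num z = s.num z := by
  have hmem := angle_mem ha hb
  have habs : |a - b| < 360 := abs_lt.2 ⟨by linarith [ha.1, hb.2], by linarith [ha.2, hb.1]⟩
  rw [angleCostOf]
  simp only [block_cons_cons, block_singleton, runs_seq]
  have first : Runs c (Cmd.ite (BExp.rlt (RExp.var rX) (RExp.lit 0))
      (setR rX (RExp.sub (RExp.lit 0) (RExp.var rX))) skip) s fun s' t =>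
        t ≤ 15 ∧ s'.nat = s.nat ∧ (∀ z, z ≠ rX → s'.num z = s.num z) ∧
          s'.num rX 0 = ((|a - b| : ℝ) : EReal) := by
    rw [runs_ite, runs_setR, runs_skip]
    simp only [RExp.eval, RExp.var, BExp.holds, NExp.eval, hx]
    constructor
    · intro hlt
      have hlt' : a - b < 0 := by exact_mod_cast hlt
      refine ⟨by simp, by simp, fun z hz => by simp at hz; simp [hz], ?_⟩
      rw [abs_of_neg hlt', State.setNum_num, if_pos rfl, if_pos rfl, ← EReal.coe_sub]
      simp
    · intro hlt
      have hlt' : 0 ≤ a - b := not_lt.1 fun h => hlt (by exact_mod_cast h)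
      rw [abs_of_nonneg hlt']
      simp
  refine first.mono ?_
  rintro s₁ t₁ ⟨ht₁, hn₁, hr₁, hx₁⟩
  have second : Runs c (Cmd.ite (BExp.rlt (RExp.lit 180) (RExp.var rX))
      (setR rX (RExp.sub (RExp.lit 360) (RExp.var rX))) skip) s₁ fun s' t =>
        t ≤ 15 ∧ s'.nat = s.nat ∧ (∀ z, z ≠ rX → s'.num z = s.num z) ∧
          s'.num rX 0 = ((angle (a - b) : ℝ) : EReal) := by
    rw [runs_ite, runs_setR, runs_skip]
    simp only [RExp.eval, RExp.var, BExp.holds, NExp.eval, hx₁]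
    constructor
    · intro hlt
      have hlt' : 180 < |a - b| := by exact_mod_cast hlt
      refine ⟨by simp, by simpa using hn₁, fun z hz => ?_, ?_⟩
      · have := hr₁ z hz
        simp at hz; simpa [hz] using this
      · rw [State.setNum_num, if_pos rfl, if_pos rfl, ← EReal.coe_sub, angle,
          min_eq_right (by linarith)]
        simp
    · intro hlt
      have hlt' : |a - b| ≤ 180 := not_lt.1 fun h => hlt (by exact_mod_cast h)
      refine ⟨by simp, hn₁, hr₁, ?_⟩
      rw [angle, min_eq_left (by linarith)]
  refine second.mono ?_
  rintro s₂ t₂ ⟨ht₂, hn₂, hr₂, hx₂⟩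
  refine runs_angleCost _ hmem (by simpa using hx₂) ?_
  simp
  refine ⟨by omega, hn₂, fun z h1 h2 => ?_⟩
  simp [h2]
  exact hr₂ z (by simpa using h1)

/-- During the round that takes the least costs from walks with at most `t` edges to walks with at
most `t + 1` edges, the distance `x` of the edge `e` lies between the two least costs, and the
recorded predecessor `π` explains it. -/
def EdgeInv (c : ℝ → ℝ) (G : Graph) (t : ℕ) (x : EReal) (π : ℕ) (e : Fin G.m) : Prop :=
  G.minCost c (t + 1) e ≤ x ∧ x ≤ G.minCost c t e ∧
    (x ≠ ⊤ → (π = G.m ∧ G.tail e = G.source ∧ x = (G.edgeCost e : EReal)) ∨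
      ∃ e' : Fin G.m, π = e' ∧ G.head e' = G.tail e ∧
        G.minCost c t e' + ((c (angle (G.dir e' - G.dir e)) + G.edgeCost e : ℝ) : EReal) ≤ x)

theorem EdgeInv.relax {t : ℕ} {x y : EReal} {π : ℕ} {e e' : Fin G.m} (h : EdgeInv c G t x π e)
    (he : G.head e' = G.tail e) (hy : y = G.minCost c t e' +
      ((c (angle (G.dir e' - G.dir e)) + G.edgeCost e : ℝ) : EReal)) (hlt : y < x) :
    EdgeInv c G t y e' e :=
  ⟨hy ▸ Graph.minCost_succ_le_add he, hlt.le.trans h.2.1, fun _ => Or.inr ⟨e', rfl, he, hy.ge⟩⟩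

theorem runs_relaxVertex {t : ℕ} (ht : 1 ≤ t) {s : State} (h : HoldsGraph s G p) (v : Fin G.n)
    (hv : s.nat nV 0 = v)
    {f : Fin (G.inDeg v) → Fin G.m}
    (hf : ∀ i, G.head (f i) = v ∧ s.nat nInEdge (s.nat nInOff v + i) = f i)
    (hf' : ∀ e, G.head e = v → ∃ i, f i = e)
    {g : Fin (G.outDeg v) → Fin G.m}
    (hg : ∀ j, G.tail (g j) = v ∧ s.nat nOutEdge (s.nat nOutOff v + j) = g j)
    (hg' : ∀ e, G.tail e = v → ∃ j, g j = e)
    (hs : HoldsVertex s (fun i => G.minCost c t (f i)) (fun i => G.dir (f i))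
      (fun j => G.dir (g j)))
    (hpred : 0 < G.inDeg v → ∀ j : Fin (G.outDeg v), IsOptPred c (fun i => G.minCost c t (f i))
      (fun i => G.dir (f i)) (fun j => G.dir (g j)) (s.nat nPred j) j)
    (hinv : ∀ e : Fin G.m, EdgeInv c G t (s.num rNewDist e) (s.nat nParent e) e) :
    Runs c relaxVertex s fun s' T => T ≤ G.outDeg v * 200 + 50 ∧
      ∀ e : Fin G.m, EdgeInv c G t (s'.num rNewDist e) (s'.nat nParent e) e ∧
        s'.num rNewDist e ≤ s.num rNewDist e ∧
          (G.tail e = v → s'.num rNewDist e ≤ G.minCost c (t + 1) e) := by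
  obtain ⟨hK, hL, hin, hout⟩ := hs
  have hcost : ∀ e : Fin G.m, s.num rEdgeCost e = (G.edgeCost e : EReal) :=
    fun e => (h.2.2.2.2.1 e).2
  rw [relaxVertex, runs_ite]
  refine ⟨fun hpos => ?_, fun hpos => ?_⟩
  · have hpos' : 0 < G.inDeg v := by simp at hpos hK; omega
    refine (runs_forRange (fun x s' => s'.nat nL 0 = G.outDeg v ∧ s'.nat nV 0 = v ∧
      s'.nat nInOff = s.nat nInOff ∧ s'.nat nInEdge = s.nat nInEdge ∧
      s'.nat nOutOff = s.nat nOutOff ∧ s'.nat nOutEdge = s.nat nOutEdge ∧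
      s'.nat nPred = s.nat nPred ∧ s'.num rEdgeCost = s.num rEdgeCost ∧
      s'.num rInDist = s.num rInDist ∧ s'.num rInDir = s.num rInDir ∧
      s'.num rOutDir = s.num rOutDir ∧
      (∀ e : Fin G.m, EdgeInv c G t (s'.num rNewDist e) (s'.nat nParent e) e ∧
        s'.num rNewDist e ≤ s.num rNewDist e) ∧
      ∀ j : Fin (G.outDeg v), j < x → s'.num rNewDist (g j) ≤ G.minCost c (t + 1) (g j)) 150 0
      (G.outDeg v) (by simp) (Nat.zero_le _) ?_ ?_ ?_).mono ?_
    · simp at hL hv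
      simp [hL, hv]
      simpa using hinv
    · rintro i s - - ⟨h, -⟩ -
      simpa using h
    · rintro x s₁ - hx ⟨h1, h2, h3, h4, h5, h6, h7, h8, h9, h10, h11, h12, h13⟩ h14
      obtain ⟨q1, q2⟩ := hg ⟨x, hx⟩
      obtain ⟨i, hi, hopt⟩ := hpred hpos' ⟨x, hx⟩
      obtain ⟨q3, q4⟩ := hf i
      have q5 := hout ⟨x, hx⟩
      obtain ⟨q6, q7⟩ := hin i
      simp only [block_cons_cons, block_singleton, runs_seq, runs_setN, runs_setR]
      refine (runs_angleCostOf (a := G.dir (f i)) (b := G.dir (g ⟨x, hx⟩)) (G.dir_mem _)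
        (G.dir_mem _) ?_).mono ?_
      · simp at h2 h5 h6 h7 h10 h11 h14 q2 hi q5 q7
        simp [h2, h5, h6, h7, h10, h11, h14, q2, hi, q5, q7]
      rintro s₂ t₂ ⟨ht₂, hn, hy, hr⟩
      have e0 : s₂.num 0 = s.num 0 := by
        rw [hr 0 (by simp) (by simp)]; simp at h9; simp [h9]
      have e1 : s₂.num 1 = s.num 1 := by
        rw [hr 1 (by simp) (by simp)]; simp at h10; simp [h10]
      have e2 : s₂.num 2 = s.num 2 := by
        rw [hr 2 (by simp) (by simp)]; simp at h11; simp [h11]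
      have e4 : s₂.num 4 = s.num 4 := by
        rw [hr 4 (by simp) (by simp)]; simp at h8; simp [h8]
      have e6 : s₂.num 6 = s₁.num 6 := by
        rw [hr 6 (by simp) (by simp)]; simp
      clear hr
      have hnew := h12 (g ⟨x, hx⟩)
      set y : EReal := G.minCost c t (f i) +
        ((c (angle (G.dir (f i) - G.dir (g ⟨x, hx⟩))) + G.edgeCost (g ⟨x, hx⟩) : ℝ) : EReal) with hydef
      have hy' : G.minCost c t (f i) + (((c (angle (G.dir (f i) - G.dir (g ⟨x, hx⟩))) : ℝ) : EReal)
          + (G.edgeCost (g ⟨x, hx⟩) : EReal)) = y := by rw [hydef, EReal.coe_add]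
      have hhead : G.head (f i) = G.tail (g ⟨x, hx⟩) := q3.trans q1.symm
      -- the predecessor is optimal, so a value that is at most the old distance and at most the
      -- distance through it is a lower bound for all walks with at most `t + 1` edges
      have hbest : ∀ z, z ≤ s₁.num rNewDist (g ⟨x, hx⟩) → z ≤ y →
          z ≤ G.minCost c (t + 1) (g ⟨x, hx⟩) := by
        intro z hz1 hz2
        refine Graph.le_minCost_succ ht (hz1.trans hnew.1.2.1) fun e' he' => hz2.trans ?_
        obtain ⟨i', rfl⟩ := hf' e' (he'.trans q1)
        rw [hydef, EReal.coe_add, EReal.coe_add, ← add_assoc, ← add_assoc]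
        exact add_le_add_left (hopt i') _
      simp only [runs_ite]
      simp at h1 h2 h3 h4 h5 h6 h7 h8 h9 h10 h11 h12 h13 h14 q2 q4 q5 q6 q7 hi hy hcost hnew hbest
      simp only [RExp.eval, NExp.eval, RExp.var, NExp.var, BExp.holds]
      simp [hn, e0, e1, e2, e4, e6, h1, h2, h3, h4, h5, h6, h7, h14, q2, q4, q6, hi, hy, hcost,
        hy']
      refine ⟨fun hlt => ⟨by omega, fun e => ?_, fun j hj => ?_⟩,
        fun hlt => ⟨by omega, h12, fun j hj => ?_⟩⟩
      · by_cases he : e = g ⟨x, hx⟩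
        · subst he
          simp only [if_true]
          exact ⟨hnew.1.relax hhead hydef hlt, hlt.le.trans hnew.2⟩
        · have he' : ((e : ℕ) ≠ g ⟨x, hx⟩) := fun h => he (Fin.ext h)
          simp only [he', if_false]
          exact h12 e
      · by_cases he : g j = g ⟨x, hx⟩
        · rw [he]
          simp only [if_true]
          exact hbest y hlt.le le_rfl
        · have he' : ((g j : ℕ) ≠ g ⟨x, hx⟩) := fun h => he (Fin.ext h)
          simp only [he', if_false]
          refine h13 j (lt_of_le_of_ne hj fun h => he ?_)
          congr 1
          exact Fin.ext h
      · rcases hj.lt_or_eq with hj | hj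
        · exact h13 j hj
        · obtain rfl : j = ⟨x, hx⟩ := Fin.ext hj
          exact hbest _ le_rfl hlt
    · rintro s₁ t₁ ⟨⟨-, -, -, -, -, -, -, -, -, -, -, h1, h2⟩, -, h3⟩
      refine ⟨by simp at h3 ⊢; omega, fun e => ⟨(h1 e).1, (h1 e).2, fun he => ?_⟩⟩
      obtain ⟨j, rfl⟩ := hg' e he
      exact h2 j j.2
  · have hpos' : G.inDeg v = 0 := by simp at hpos hK; omega
    simp only [runs_skip]
    refine ⟨by simp, fun e => ⟨hinv e, le_rfl, fun he => ?_⟩⟩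
    refine Graph.le_minCost_succ ht (hinv e).2.1 fun e' he' => ?_
    obtain ⟨i, -⟩ := hf' e' (he'.trans he)
    exact absurd i.2 (by omega)

end

/-! ### Minimal-angle Bellman-Ford -/

section

attribute [local simp] NExp.eval NExp.cost NExp.var RExp.eval RExp.cost RExp.var BExp.holds BExp.cost
  runs_skip runs_storeN runs_storeR runs_setN runs_setR runs_seq runs_ite block_cons_cons
  block_singleton nK nL nPred nVertices nEdges nP nSource nInOff nInEdge nOutOff nOutEdge nParent nT
  nV nJ nE nI rInDist rInDir rOutDir rDir rEdgeCost rDist rNewDist rX rY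

variable {G : Graph} {p : ℕ}

/-- A bound on the number of operations that a round spends on a vertex. -/
def vertexTime (G : Graph) (v : Fin G.n) : ℕ :=
  updateTime (G.inDeg v) (G.outDeg v) + (G.inDeg v + G.outDeg v) * 260 + 120

theorem runs_vertex (hc : ConvexOn ℝ (Set.Icc 0 180) c) (hm : MonotoneOn c (Set.Icc 0 180))
    (h0 : ∀ x ∈ Set.Icc (0 : ℝ) 180, 0 ≤ c x) {t : ℕ} (ht : 1 ≤ t) {s : State}
    (h : HoldsGraph s G p) (v : Fin G.n) (hv : s.nat nV 0 = v)
    (hd : ∀ e : Fin G.m, s.num rDist e = G.minCost c t e)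
    (hinv : ∀ e : Fin G.m, EdgeInv c G t (s.num rNewDist e) (s.nat nParent e) e) :
    Runs c (block [loadVertex, updateVertex, relaxVertex]) s fun s' T => T ≤ vertexTime G v ∧
      HoldsGraph s' G p ∧ s'.nat nV 0 = v ∧ s'.nat nT = s.nat nT ∧
      (∀ e : Fin G.m, s'.num rDist e = G.minCost c t e) ∧
      ∀ e : Fin G.m, EdgeInv c G t (s'.num rNewDist e) (s'.nat nParent e) e ∧
        s'.num rNewDist e ≤ s.num rNewDist e ∧
          (G.tail e = v → s'.num rNewDist e ≤ G.minCost c (t + 1) e) := by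
  obtain ⟨f, hf, hf'⟩ := h.exists_inEdges v
  obtain ⟨g, hg, hg'⟩ := h.exists_outEdges v
  simp only [block_cons_cons, block_singleton, runs_seq]
  refine (runs_loadVertex h v hv hd (fun i => (hf i).2) (fun j => (hg j).2)).frame.mono ?_
  rintro s₁ t₁ ⟨⟨ht₁, hV⟩, fn₁, fr₁⟩
  refine (runs_updateVertex hc hm (fun i => Graph.minCost_ne_bot h0 ht) (fun i => G.dir_mem _)
    (fun j => G.dir_mem _) hV).frame.mono ?_
  rintro s₂ t₂ ⟨⟨ht₂, hpred⟩, fn₂, fr₂⟩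
  have gn : ∀ a, a < 20 → a ≠ nPred → s₂.nat a = s₁.nat a := fun a h1 h2 =>
    fn₂ a fun h3 => (natWrites_updateVertex a h3).elim h2 (by omega)
  have gr : ∀ a, a < 20 → s₂.num a = s₁.num a := fun a h1 =>
    fr₂ a fun h3 => by have := numWrites_updateVertex a h3; omega
  have hn : ∀ a, 3 ≤ a → a ≤ 13 → s₂.nat a = s.nat a := fun a h1 h2 =>
    (gn a (by omega) (by simp; omega)).trans (fn₁ a (by
      clear fn₁ fn₂ gn; revert a; decide))
  have hr : ∀ a, 3 ≤ a → a ≤ 6 → s₂.num a = s.num a := fun a h1 h2 =>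
    (gr a (by omega)).trans (fr₁ a (by clear fr₁ fr₂ gr; revert a; decide))
  have hV₂ : HoldsVertex s₂ (fun i => G.minCost c t (f i)) (fun i => G.dir (f i))
      (fun j => G.dir (g j)) := by
    unfold HoldsVertex at *
    rw [gn nK (by simp) (by simp), gn nL (by simp) (by simp), gr rInDist (by simp),
      gr rInDir (by simp), gr rOutDir (by simp)]
    exact hV
  have h₂ : HoldsGraph s₂ G p := h.congr (fun a h1 h2 => hn a h1 (by omega))
    (fun a h1 h2 => hr a h1 (by omega))
  refine (runs_relaxVertex ht h₂ v (by rw [hn nV (by simp) (by simp)]; exact hv) (f := f) (g := g)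
    (fun i => ?_) hf' (fun j => ?_) hg' hV₂ hpred ?_).frame.mono ?_
  · rw [hn nInEdge (by simp) (by simp), hn nInOff (by simp) (by simp)]
    exact hf i
  · rw [hn nOutEdge (by simp) (by simp), hn nOutOff (by simp) (by simp)]
    exact hg j
  · rw [hn nParent (by simp) (by simp), hr rNewDist (by simp) (by simp)]
    exact hinv
  rintro s₃ t₃ ⟨⟨ht₃, hres⟩, fn₃, fr₃⟩
  refine ⟨?_, h₂.congr (fun a h1 h2 => fn₃ a ?_) (fun a h1 h2 => fr₃ a ?_), ?_, ?_, ?_, ?_⟩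
  · unfold vertexTime; omega
  · clear fn₁ fn₂ gn fn₃ hn; revert a; decide
  · clear fr₁ fr₂ gr fr₃ hr; revert a; decide
  · rw [fn₃ nV (by decide), hn nV (by simp) (by simp)]; exact hv
  · rw [fn₃ nT (by decide), hn nT (by simp) (by simp)]
  · rw [fr₃ rDist (by decide), hr rDist (by simp) (by simp)]; exact hd
  · rw [← hr rNewDist (by simp) (by simp)]; exact hres

/-- After `t - 1` rounds the distances are the least costs of walks with at most `t` edges, and the
recorded predecessors explain them. -/
def RoundInv (c : ℝ → ℝ) (G : Graph) (p t : ℕ) (s : State) : Prop :=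
  HoldsGraph s G p ∧ ∀ e : Fin G.m, s.num rDist e = G.minCost c t e ∧
    (G.minCost c t e ≠ ⊤ →
      (s.nat nParent e = G.m ∧ G.tail e = G.source ∧ G.minCost c t e = (G.edgeCost e : EReal)) ∨
        ∃ e' : Fin G.m, s.nat nParent e = e' ∧ G.head e' = G.tail e ∧
          G.minCost c t e' + ((c (angle (G.dir e' - G.dir e)) + G.edgeCost e : ℝ) : EReal) ≤
            G.minCost c t e)

theorem RoundInv.edgeInv {t : ℕ} {s : State} (h : RoundInv c G p t s) (e : Fin G.m) :
    EdgeInv c G t (G.minCost c t e) (s.nat nParent e) e :=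
  ⟨Graph.minCost_succ_le, le_rfl, (h.2 e).2⟩

/-- The body of the main loop of `bellmanFord`. -/
def round (U : Cmd) : Cmd :=
  block [
    forRange nE (NExp.lit 0) (NExp.var nEdges)
      (storeR rNewDist (NExp.var nE) (RExp.get rDist (NExp.var nE))),
    forRange nV (NExp.lit 0) (NExp.var nVertices) (block [loadVertex, U, relaxVertex]),
    forRange nE (NExp.lit 0) (NExp.var nEdges)
      (storeR rDist (NExp.var nE) (RExp.get rNewDist (NExp.var nE)))]

theorem runs_round (hc : ConvexOn ℝ (Set.Icc 0 180) c) (hm : MonotoneOn c (Set.Icc 0 180))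
    (h0 : ∀ x ∈ Set.Icc (0 : ℝ) 180, 0 ≤ c x) {t : ℕ} (ht : 1 ≤ t) {s : State}
    (h : RoundInv c G p t s) :
    Runs c (round updateVertex) s fun s' T =>
      T ≤ ∑ v, (vertexTime G v + 20) + G.m * 50 + 50 ∧ s'.nat nT = s.nat nT ∧
        RoundInv c G p (t + 1) s' := by
  rw [round]
  simp only [block_cons_cons, block_singleton, runs_seq]
  refine ((runs_forRange (fun x s' => s'.nat nEdges 0 = G.m ∧ s'.num rDist = s.num rDist ∧
    ∀ e < x, s'.num rNewDist e = s.num rDist e) 10 0 G.m (by simp) (Nat.zero_le _)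
    ?_ ?_ ?_).frame).mono ?_
  · simpa using h.1.2.1
  · rintro i s - - ⟨h, -⟩ -
    simpa using h
  · rintro x s₁ - hx ⟨h1, h2, h3⟩ h4
    simp at h1 h2 h3 h4
    simp [h1, h2, h4]
    intro e he
    split_ifs with hex
    · rw [hex]
    · exact h3 e (by omega)
  rintro s₁ t₁ ⟨⟨⟨-, a1, a2⟩, -, ht₁⟩, fn, fr⟩
  have hG₁ : HoldsGraph s₁ G p := h.1.congr (fun a h1 h2 => fn a (by clear fn; revert a; decide))
    (fun a h1 h2 => fr a (by clear fr; revert a; decide))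
  have hpar : s₁.nat nParent = s.nat nParent := fn nParent (by decide)
  have hT : s₁.nat nT = s.nat nT := fn nT (by decide)
  clear fn fr
  refine (runs_forRange_sum (fun x s' => HoldsGraph s' G p ∧ s'.nat nT = s.nat nT ∧
    (∀ e : Fin G.m, s'.num rDist e = G.minCost c t e) ∧
    ∀ e : Fin G.m, EdgeInv c G t (s'.num rNewDist e) (s'.nat nParent e) e ∧
      (G.tail e < x → s'.num rNewDist e ≤ G.minCost c (t + 1) e))
    (fun x => if hx : x < G.n then vertexTime G ⟨x, hx⟩ else 0) 0 G.n (by simp) (Nat.zero_le _)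
    ?_ ?_ ?_).mono ?_
  · refine ⟨hG₁.congr (fun a h1 h2 => State.setNat_nat_of_ne _ _ _ (by simp; omega))
      (fun a h1 h2 => rfl), ?_, fun e => ?_, fun e => ⟨?_, fun hlt => by omega⟩⟩
    · rw [State.setNat_nat_of_ne _ _ _ (by simp)]; exact hT
    · rw [State.setNat_num, a1]; exact (h.2 e).1
    · rw [State.setNat_num, a2 e e.2, State.setNat_nat_of_ne _ _ _ (by simp), hpar, (h.2 e).1]
      exact h.edgeInv e
  · rintro i s' - - ⟨h1, -⟩ -
    exact h1.1
  · rintro x s₂ - hx ⟨b1, b2, b3, b4⟩ b5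
    refine (runs_vertex hc hm h0 ht b1 ⟨x, hx⟩ b5 b3 (fun e => (b4 e).1)).mono ?_
    rintro s₃ t₃ ⟨c1, c2, c3, c4, c5, c6⟩
    refine ⟨by simpa [hx] using c1, c3, c2.congr
      (fun a h1 h2 => State.setNat_nat_of_ne _ _ _ (by simp; omega)) (fun a h1 h2 => rfl), ?_, c5,
      fun e => ⟨?_, fun hlt => ?_⟩⟩
    · rw [State.setNat_nat_of_ne _ _ _ (by simp), c4, b2]
    · rw [State.setNat_num, State.setNat_nat_of_ne _ _ _ (by simp)]; exact (c6 e).1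
    · rw [State.setNat_num]
      rcases Nat.lt_succ_iff_lt_or_eq.1 hlt with hlt | heq
      · exact (c6 e).2.1.trans ((b4 e).2 hlt)
      · exact (c6 e).2.2 (Fin.ext heq)
  rintro s₂ t₂ ⟨⟨b1, b2, b3, b4⟩, -, ht₂⟩
  have hnew : ∀ e : Fin G.m, s₂.num rNewDist e = G.minCost c (t + 1) e := fun e =>
    le_antisymm ((b4 e).2 (G.tail e).2) (b4 e).1.1
  refine ((runs_forRange (fun x s' => s'.nat nEdges 0 = G.m ∧ s'.num rNewDist = s₂.num rNewDist ∧
    ∀ e < x, s'.num rDist e = s₂.num rNewDist e) 10 0 G.m (by simp) (Nat.zero_le _)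
    ?_ ?_ ?_).frame).mono ?_
  · simpa using b1.2.1
  · rintro i s - - ⟨h, -⟩ -
    simpa using h
  · rintro x s₃ - hx ⟨h1, h2, h3⟩ h4
    simp at h1 h2 h3 h4
    simp [h1, h2, h4]
    intro e he
    split_ifs with hex
    · rw [hex]
    · exact h3 e (by omega)
  rintro s₃ t₃ ⟨⟨⟨-, -, d2⟩, -, ht₃⟩, fn, fr⟩
  refine ⟨?_, ?_, b1.congr (fun a h1 h2 => fn a (by clear fn; revert a; decide))
    (fun a h1 h2 => fr a (by clear fr; revert a; decide)), fun e => ⟨?_, fun hfin => ?_⟩⟩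
  · have e1 : ∑ i ∈ Finset.Ico 0 G.n, ((if hx : i < G.n then vertexTime G ⟨i, hx⟩ else 0) +
        (NExp.var nVertices).cost + 10) ≤ ∑ v, (vertexTime G v + 20) := by
      rw [← Finset.range_eq_Ico, Finset.sum_range]
      refine Finset.sum_le_sum fun v _ => ?_
      simp
    simp at ht₁ ht₂ ht₃ e1 ⊢
    omega
  · rw [fn nT (by decide)]; exact b2
  · rw [d2 e e.2]; exact hnew e
  · rw [fn nParent (by decide)]
    have h1 := (b4 e).1.2.2
    rw [hnew e] at h1
    rcases h1 hfin with h2 | ⟨e', h2, h3, h4⟩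
    · exact Or.inl h2
    · exact Or.inr ⟨e', h2, h3, (add_le_add_left Graph.minCost_succ_le _).trans h4⟩

theorem sum_inDeg (G : Graph) : ∑ v, G.inDeg v = G.m := by
  simpa [Graph.inDeg] using (Finset.card_eq_sum_card_fiberwise (f := G.head)
    (s := Finset.univ) (t := Finset.univ) (fun _ _ => Finset.mem_univ _)).symm

theorem outDeg_le (G : Graph) (v : Fin G.n) : G.outDeg v ≤ G.m := by
  simpa [Graph.outDeg] using Finset.card_filter_le Finset.univ fun e => G.tail e = v

theorem one_le_degree (h : ∀ v, ∃ e, G.tail e = v ∨ G.head e = v) (v : Fin G.n) :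
    1 ≤ G.inDeg v + G.outDeg v := by
  obtain ⟨e, he | he⟩ := h v
  · have : 0 < G.outDeg v := Finset.card_pos.2 ⟨e, by simp [he]⟩
    omega
  · have : 0 < G.inDeg v := Finset.card_pos.2 ⟨e, by simp [he]⟩
    omega

theorem runs_bellmanFord (hc : ConvexOn ℝ (Set.Icc 0 180) c) (hm : MonotoneOn c (Set.Icc 0 180))
    (h0 : ∀ x ∈ Set.Icc (0 : ℝ) 180, 0 ≤ c x) (hp : 1 ≤ p) {s : State}
    (hdeg : ∀ v, ∃ e, G.tail e = v ∨ G.head e = v) (h : HoldsGraph s G p) :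
    Runs c (bellmanFord updateVertex) s fun s' t =>
      t ≤ p * ∑ v, (updateTime (G.inDeg v) (G.outDeg v) + (G.inDeg v + G.outDeg v) * 600) ∧
        RoundInv c G p p s' := by
  rw [bellmanFord]
  simp only [block_cons_cons, block_singleton, runs_seq]
  refine (runs_initDist h).mono ?_
  rintro s₁ t₁ ⟨ht₁, h₁, hd⟩
  have hinv : RoundInv c G p 1 s₁ := by
    refine ⟨h₁, fun e => ⟨(hd e).1, fun hfin => Or.inl ⟨(hd e).2, ?_⟩⟩⟩
    by_cases he : G.tail e = G.source
    · exact ⟨he, Graph.minCost_one_of_tail_eq he⟩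
    · exact absurd (Graph.minCost_one_of_tail_ne he) hfin
  have hcongr : ∀ {t : ℕ} {s : State} (x : ℕ), RoundInv c G p t s →
      RoundInv c G p t (s.setNat nT 0 x) := by
    intro t s x h
    refine ⟨h.1.congr (fun a h1 h2 => State.setNat_nat_of_ne _ _ _ (by simp; omega))
      (fun a h1 h2 => rfl), fun e => ?_⟩
    rw [State.setNat_num, State.setNat_nat_of_ne _ _ _ (by simp)]
    exact h.2 e
  refine (runs_forRange (fun t s' => RoundInv c G p t s')
    (∑ v, (vertexTime G v + 20) + G.m * 50 + 50) 1 p (by simp) hp (hcongr _ hinv) ?_ ?_).mono ?_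
  · rintro i s' - - h' -
    exact h'.1.2.2.1
  · rintro t s' ht - h' hx
    refine (runs_round hc hm h0 ht h').mono ?_
    rintro s₂ t₂ ⟨k1, k2, k3⟩
    exact ⟨k1, by rw [k2]; exact hx, hcongr _ k3⟩
  · rintro s₂ t₂ ⟨hR, -, ht₂⟩
    refine ⟨?_, hR⟩
    obtain ⟨q, rfl⟩ : ∃ q, p = q + 1 := ⟨p - 1, by omega⟩
    have hdeg' : ∀ v, 1 ≤ G.inDeg v + G.outDeg v := one_le_degree hdeg
    have hm' := sum_inDeg G
    set N := ∑ v, (G.inDeg v + G.outDeg v) with hN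
    have hmN : G.m ≤ N := by
      rw [← hm']; exact Finset.sum_le_sum fun v _ => Nat.le_add_right _ _
    have hN1 : 1 ≤ N := (hdeg' G.source).trans
      (Finset.single_le_sum (f := fun v => G.inDeg v + G.outDeg v) (fun _ _ => Nat.zero_le _)
        (Finset.mem_univ _))
    have hW : ∑ v, (vertexTime G v + 20) ≤
        ∑ v, updateTime (G.inDeg v) (G.outDeg v) + N * 400 := by
      rw [hN, Finset.sum_mul, ← Finset.sum_add_distrib]
      refine Finset.sum_le_sum fun v _ => ?_
      have := hdeg' v
      unfold vertexTime; omega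
    have hsrc := outDeg_le G G.source
    have e1 : ∑ v, (updateTime (G.inDeg v) (G.outDeg v) + (G.inDeg v + G.outDeg v) * 600)
        = ∑ v, updateTime (G.inDeg v) (G.outDeg v) + N * 600 := by
      rw [hN, Finset.sum_mul, ← Finset.sum_add_distrib]
    rw [e1, Nat.add_mul, Nat.one_mul]
    have e2 := Nat.mul_le_mul_left q (show ∑ v, (vertexTime G v + 20) + G.m * 50 + 50 +
      (NExp.var nP).cost + 10 ≤ ∑ v, updateTime (G.inDeg v) (G.outDeg v) + N * 600 by simp; omega)
    simp at ht₂ e2 ⊢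
    omega

end

end AngleBF

theorem mainTheorem2 :
    ∃ (U : AngleBF.Cmd) (C : ℝ), ∀ c : ℝ → ℝ,
      ConvexOn ℝ (Set.Icc 0 180) c → MonotoneOn c (Set.Icc 0 180) →
      (∀ x ∈ Set.Icc (0 : ℝ) 180, 0 ≤ c x) →
      -- one vertex update
      (∀ (k l : ℕ) (D : Fin k → EReal) (α : Fin k → ℝ) (β : Fin l → ℝ) (s : AngleBF.State),
        1 ≤ k + l → (∀ i, D i ≠ ⊥) →
        (∀ i, α i ∈ Set.Ico (0 : ℝ) 360) → (∀ j, β j ∈ Set.Ico (0 : ℝ) 360) →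
        AngleBF.HoldsVertex s D α β →
        ∃ (s' : AngleBF.State) (t : ℕ), AngleBF.Exec c U s s' t ∧
          (t : ℝ) ≤ C * (((k : ℝ) + l) * Real.log (2 + (k : ℝ) * l)) ∧
          (0 < k → ∀ j : Fin l, ∃ i : Fin k, s'.nat AngleBF.nPred j = i ∧
            ∀ i' : Fin k, D i + ((c (AngleBF.angle (α i - β j)) : ℝ) : EReal) ≤
              D i' + ((c (AngleBF.angle (α i' - β j)) : ℝ) : EReal))) ∧
      -- the whole algorithm
      (∀ (G : AngleBF.Graph) (p : ℕ) (s : AngleBF.State),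
        1 ≤ p → (∀ v, ∃ e, G.tail e = v ∨ G.head e = v) → AngleBF.HoldsGraph s G p →
        ∃ (s' : AngleBF.State) (t : ℕ), AngleBF.Exec c (AngleBF.bellmanFord U) s s' t ∧
          (t : ℝ) ≤ C * (p * ∑ v, ((G.inDeg v : ℝ) + G.outDeg v) *
            Real.log (2 + (G.outDeg v : ℝ) * G.inDeg v)) ∧
          (∀ e : Fin G.m, s'.num AngleBF.rDist e = G.minCost c p e) ∧
          ∀ e : Fin G.m, G.minCost c p e ≠ ⊤ →
            (s'.nat AngleBF.nParent e = G.m ∧ G.tail e = G.source ∧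
              G.minCost c p e = (G.edgeCost e : EReal)) ∨
            ∃ e' : Fin G.m, s'.nat AngleBF.nParent e = e' ∧ G.head e' = G.tail e ∧
              G.minCost c p e' + ((c (AngleBF.angle (G.dir e' - G.dir e)) + G.edgeCost e : ℝ) :
                EReal) ≤ G.minCost c p e) := by
  refine ⟨AngleBF.updateVertex, 82000, fun c hc hm h0 => ⟨?_, ?_⟩⟩
  · intro k l D α β s hkl hD hα hβ hs
    obtain ⟨s', t, hexec, ht, hopt⟩ := AngleBF.runs_updateVertex hc hm hD hα hβ hs
    refine ⟨s', t, hexec, ?_, hopt⟩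
    have h1 : (t : ℝ) ≤ AngleBF.updateTime k l := by exact_mod_cast ht
    refine (h1.trans (AngleBF.updateTime_le hkl)).trans
      (mul_le_mul_of_nonneg_right (by norm_num) ?_)
    have := AngleBF.half_le_log k l
    positivity
  · intro G p s hp hdeg hs
    obtain ⟨s', t, hexec, ht, hR⟩ := AngleBF.runs_bellmanFord hc hm h0 hp hdeg hs
    refine ⟨s', t, hexec, ?_, fun e => (hR.2 e).1, fun e => (hR.2 e).2⟩
    have h1 : (t : ℝ) ≤ (p * ∑ v, (AngleBF.updateTime (G.inDeg v) (G.outDeg v) +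
      (G.inDeg v + G.outDeg v) * 600) : ℕ) := by exact_mod_cast ht
    refine h1.trans ?_
    push_cast
    rw [mul_left_comm]
    refine mul_le_mul_of_nonneg_left ?_ (Nat.cast_nonneg p)
    rw [Finset.mul_sum]
    refine Finset.sum_le_sum fun v _ => ?_
    have h2 := AngleBF.updateTime_le (AngleBF.one_le_degree hdeg v)
    have h3 := AngleBF.half_le_log (G.inDeg v) (G.outDeg v)
    rw [mul_comm (G.outDeg v : ℝ)]
    have h4 := mul_le_mul_of_nonneg_left h3
      (show (0 : ℝ) ≤ (G.inDeg v : ℝ) + G.outDeg v by positivity)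
    linarith
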